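/- Let $\Gamma_{CK}=\langle a,b,c,d\mid [a,b]=[b,c]=[c,d]=1\rangle$, and let $X_{CK}$ be the universal covering of the square complex that has one vertex, four edges labelled $a,b,c,d$, and three squares attached along the relators $aba^{-1}b^{-1}$, $bcb^{-1}c^{-1}$, $cdc^{-1}d^{-1}$; this is a locally finite CAT(0) cube complex. Let $\mathrm{Aut}(X_{CK})$ be the group of its cubical isometries, with the compact-open topology, which makes it a topological group. A halfspace of $X_{CK}$ is a connected component of the complement of a hyperplane, and $\mathrm{Aut}^{+}(X_{CK})$ is the subgroup generated by the elements of $\mathrm{Aut}(X_{CK})$ that fix some halfspace pointwise, with the subspace topology. Then the quotient $\mathrm{Aut}(X_{CK})/\overline{\mathrm{Aut}^{+}(X_{CK})}$ is not compact, while $\mathrm{Aut}^{+}(X_{CK})$ is simple (as an abstract group), non-discrete, totally disconnected and locally compact. -/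

import Mathlib

open Topology

noncomputable section

namespace CrokeKleiner

/-- The four standard generators of the Croke-Kleiner group. -/
inductive Gen : Type
  | a
  | b
  | c
  | d

/-- The word `x y x⁻¹ y⁻¹`. -/
def commWord (x y : Gen) : FreeGroup Gen :=
  FreeGroup.of x * FreeGroup.of y * (FreeGroup.of x)⁻¹ * (FreeGroup.of y)⁻¹

/-- The relators `[a,b]`, `[b,c]`, `[c,d]`. -/
def relators : Set (FreeGroup Gen) :=
  {commWord Gen.a Gen.b, commWord Gen.b Gen.c, commWord Gen.c Gen.d}

/-- The right-angled Artin group `⟨a, b, c, d ∣ [a,b] = [b,c] = [c,d] = 1⟩`. -/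
abbrev Grp : Type := PresentedGroup relators

/-- The image of a generator in the group. -/
def gen (s : Gen) : Grp := PresentedGroup.of s

/-- The pairs of generators that occur in the defining relators, in either order. -/
inductive Linked : Gen → Gen → Prop
  | ab : Linked Gen.a Gen.b
  | ba : Linked Gen.b Gen.a
  | bc : Linked Gen.b Gen.c
  | cb : Linked Gen.c Gen.b
  | cd : Linked Gen.c Gen.d
  | dc : Linked Gen.d Gen.c

/-!
The universal cover `X` of the complex with one vertex, four edges and three squares attached along
the relators: its vertices are the group elements, its edges join `v` to `v s`, and its squares
have corners `v`, `v s`, `v s t`, `v t` with `s`, `t` generators linked by a relator.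
-/

/-- `x` is the generator `s` or its inverse. -/
def IsLetter (s : Gen) (x : Grp) : Prop := x = gen s ∨ x = (gen s)⁻¹

/-- `v` and `w` are the endpoints of an edge of `X`. -/
def IsEdge (v w : Grp) : Prop := ∃ s x, IsLetter s x ∧ w = v * x

/-- `v`, `w`, `z`, `u` are, in this cyclic order, the corners of a square of `X`. As inverse letters
are allowed, each square occurs with every choice of first corner and of direction. -/
def IsSquareCell (v w z u : Grp) : Prop :=
  ∃ s t x y, Linked s t ∧ IsLetter s x ∧ IsLetter t y ∧ w = v * x ∧ z = v * x * y ∧ u = v * y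

/-- The vertex `v` as a point of the geometric realization (a Dirac mass). -/
def dirac (v : Grp) : Grp → ℝ := Set.indicator {v} 1

/-- The point with coordinates `(p, q) ∈ [0,1]²` in the square with corners `v`, `w`, `z`, `u`:
the edge from `v` to `w` is the `p`-axis, the edge from `v` to `u` is the `q`-axis. -/
def squarePoint (v w z u : Grp) (p q : ℝ) : Grp → ℝ :=
  ((1 - p) * (1 - q)) • dirac v + (p * (1 - q)) • dirac w + (p * q) • dirac z
    + ((1 - p) * q) • dirac u

/-- The points of the geometric realization of `X`. Every vertex and every edge of `X` lies in a
square, so the squares cover `X`. -/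
def realization : Set (Grp → ℝ) :=
  {x | ∃ v w z u, IsSquareCell v w z u ∧
    ∃ p ∈ Set.Icc (0 : ℝ) 1, ∃ q ∈ Set.Icc (0 : ℝ) 1, x = squarePoint v w z u p q}

/-- The geometric realization of `X`, with the topology of convergence of all the coordinates; as
`X` is locally finite, this is the usual topology of the cube complex. -/
abbrev X : Type := ↥realization

/-- The group of the automorphisms of the cube complex `X`: the permutations of the vertices that
carry edges to edges and squares to squares, and whose inverses do so too. -/
def autSubgroup : Subgroup (Equiv.Perm Grp) where
  carrier := {σ | (∀ v w, IsEdge (σ v) (σ w) ↔ IsEdge v w) ∧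
    ∀ v w z u, IsSquareCell (σ v) (σ w) (σ z) (σ u) ↔ IsSquareCell v w z u}
  one_mem' := ⟨fun _ _ => Iff.rfl, fun _ _ _ _ => Iff.rfl⟩
  mul_mem' := fun {σ τ} hσ hτ =>
    ⟨fun v w => (hσ.1 (τ v) (τ w)).trans (hτ.1 v w),
     fun v w z u => (hσ.2 (τ v) (τ w) (τ z) (τ u)).trans (hτ.2 v w z u)⟩
  inv_mem' := fun {σ} hσ =>
    ⟨fun v w => by simpa using (hσ.1 (σ⁻¹ v) (σ⁻¹ w)).symm,
     fun v w z u => by simpa using (hσ.2 (σ⁻¹ v) (σ⁻¹ w) (σ⁻¹ z) (σ⁻¹ u)).symm⟩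

/-- `Aut(X)`. -/
def Aut : Type := ↥autSubgroup

instance instGroupAut : Group Aut := inferInstanceAs (Group ↥autSubgroup)

/-- The permutation of the vertices that underlies an automorphism. -/
def Aut.toPerm (g : Aut) : Equiv.Perm Grp := Subtype.val g

theorem dirac_comp (g : Aut) (v : Grp) :
    (fun y => dirac v (g.toPerm.symm y)) = dirac (g.toPerm v) := by
  funext y
  by_cases h : y = g.toPerm v
  · subst h
    simp [dirac]
  · have h2 : g.toPerm.symm y ≠ v := fun e => h (by rw [← e]; simp)
    simp [dirac, Set.indicator, h, h2]

theorem squarePoint_comp (g : Aut) (v w z u : Grp) (p q : ℝ) :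
    (fun y => squarePoint v w z u p q (g.toPerm.symm y)) =
      squarePoint (g.toPerm v) (g.toPerm w) (g.toPerm z) (g.toPerm u) p q := by
  funext y
  simp only [squarePoint, ← dirac_comp, Pi.add_apply, Pi.smul_apply]

theorem comp_mem_realization (g : Aut) {x : Grp → ℝ} (hx : x ∈ realization) :
    (fun y => x (g.toPerm.symm y)) ∈ realization := by
  obtain ⟨v, w, z, u, hs, p, hp, q, hq, rfl⟩ := hx
  exact ⟨g.toPerm v, g.toPerm w, g.toPerm z, g.toPerm u, (g.2.2 v w z u).2 hs, p, hp, q, hq,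
    squarePoint_comp g v w z u p q⟩

/-- The self-map of the geometric realization that an automorphism induces: it carries each square
isometrically onto a square, in accordance with what it does to the vertices. -/
def act (g : Aut) : C(X, X) where
  toFun x := ⟨fun y => x.1 (g.toPerm.symm y), comp_mem_realization g x.2⟩
  continuous_toFun := by
    refine Continuous.subtype_mk (continuous_pi fun y => ?_) _
    exact (continuous_apply _).comp continuous_subtype_val

/-- The compact-open topology on `Aut(X)`, for the action on the geometric realization. -/
instance instTopologicalSpaceAut : TopologicalSpace Aut :=
  TopologicalSpace.induced act ContinuousMap.compactOpen

/-- Parallelism of oriented edges `(v, w)`: the equivalence relation generated by being opposite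
sides, with the same direction, of a square. -/
def Parallel : Grp × Grp → Grp × Grp → Prop :=
  Relation.EqvGen fun e f => IsSquareCell e.1 e.2 f.2 f.1

/-- The hyperplane that crosses the edge from `v` to `w`: the union of the midcubes that are dual to
the edges parallel to it. -/
def hyperplane (v w : Grp) : Set X :=
  {x | ∃ v' w' z u, Parallel (v, w) (v', w') ∧ IsSquareCell v' w' z u ∧
    ∃ q ∈ Set.Icc (0 : ℝ) 1, x.1 = squarePoint v' w' z u (1 / 2) q}

/-- The halfspaces of `X`: the connected components of the complements of the hyperplanes. -/
def IsHalfspace (h : Set X) : Prop :=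
  ∃ v w, IsEdge v w ∧ ∃ x ∈ (hyperplane v w)ᶜ, h = connectedComponentIn (hyperplane v w)ᶜ x

/-- `Aut⁺(X)`: the subgroup generated by the automorphisms that fix some halfspace pointwise. -/
def AutPlus : Subgroup Aut :=
  Subgroup.closure {g | ∃ h, IsHalfspace h ∧ ∀ x ∈ h, act g x = x}

end CrokeKleiner

end

/-!
Label each edge from `v` to `v x` by its generator, and call an automorphism labelled if it
preserves labels. It then maps each line `v ⟨s⟩` to such a line with a sign, parallel lines receive
the same sign, and an automorphism with any prescribed compatible family of signs exists. Thus the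
labelled automorphisms that fix a vertex form a group homeomorphic to the compact space of such
families.

An element that fixes a halfspace pointwise fixes an edge, and this already makes it labelled,
because the path `a - b - c - d` has no nontrivial automorphism that fixes one of its vertices.
Conversely, a labelled automorphism that fixes a vertex is a product of labelled automorphisms each
supported in a halfspace bounded by a hyperplane of label `a`. Hence `Aut⁺` contains the compact
open stabilizers above, so it is open, closed and locally compact.

For noncompactness, kill `b` and `c` and send `a` and `d` to reflections of the infinite dihedral
group: signs are invisible on involutions, so elements of `Aut⁺` move every vertex within its fibre,
while left translations by nontrivial powers of `d a` do not. The quotient is infinite and discrete.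

For simplicity, a nontrivial normal subgroup moves some halfspace off itself, and composing an
element with a conjugate of it by a reversal of a line gives `m` that carries a halfspace `A` into
itself. A labelled automorphism `f` supported in a halfspace `B` inside `A \ m A` is the commutator
of the infinite product of the conjugates `m ^ i f m ^ (-i)` with `m`, so the normal subgroup
contains it. The conjugates of these `f` generate `Aut⁺`, because `Aut⁺` maps every halfspace
bounded by a hyperplane of label `a` into `B`.
-/

noncomputable section

namespace CrokeKleiner

theorem Linked.symm {s t : Gen} (h : Linked s t) : Linked t s := by
  cases h <;> constructor

theorem Linked.ne {s t : Gen} (h : Linked s t) : s ≠ t := by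
  cases h <;> simp

theorem commute_gen_of_commWord_mem {s t : Gen} (h : commWord s t ∈ relators) :
    Commute (gen s) (gen t) := by
  have hrel : gen s * gen t * (gen s)⁻¹ * (gen t)⁻¹ = 1 := by
    simpa [commWord, gen, PresentedGroup.of] using PresentedGroup.one_of_mem h
  rwa [mul_inv_eq_one, mul_inv_eq_iff_eq_mul] at hrel

theorem commute_gen {s t : Gen} (h : Linked s t) : Commute (gen s) (gen t) := by
  cases h
  case ab | bc | cd => exact commute_gen_of_commWord_mem (by simp [relators])
  case ba | cb | dc => exact (commute_gen_of_commWord_mem (by simp [relators])).symm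

/-- The homomorphism out of `Grp` given by images of the generators that commute when linked. -/
def liftHom {G : Type*} [Group G] (f : Gen → G)
    (hf : ∀ s t, Linked s t → Commute (f s) (f t)) : Grp →* G :=
  PresentedGroup.toGroup (f := f) (by
    have lift_commWord : ∀ s t, Linked s t → FreeGroup.lift f (commWord s t) = 1 := by
      intro s t h
      simp only [commWord, map_mul, FreeGroup.lift_apply_of, map_inv]
      rw [mul_inv_eq_one, mul_inv_eq_iff_eq_mul]
      exact hf s t h
    rintro r (rfl | rfl | rfl)
    exacts [lift_commWord _ _ .ab, lift_commWord _ _ .bc, lift_commWord _ _ .cd])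

@[simp] theorem liftHom_gen {G : Type*} [Group G] (f : Gen → G)
    (hf : ∀ s t, Linked s t → Commute (f s) (f t)) (s : Gen) : liftHom f hf (gen s) = f s :=
  PresentedGroup.toGroup.of _

/-- The subgroup generated by the generators in `T`. -/
def parabolic (T : Set Gen) : Subgroup Grp := Subgroup.closure (gen '' T)

theorem gen_zpow_mem_parabolic {T : Set Gen} {s : Gen} (h : s ∈ T) (k : ℤ) :
    gen s ^ k ∈ parabolic T :=
  zpow_mem (Subgroup.subset_closure (Set.mem_image_of_mem gen h)) k

theorem gen_mem_parabolic {T : Set Gen} {s : Gen} (h : s ∈ T) : gen s ∈ parabolic T :=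
  Subgroup.subset_closure (Set.mem_image_of_mem gen h)

theorem parabolic_mono {T T' : Set Gen} (h : T ⊆ T') : parabolic T ≤ parabolic T' :=
  Subgroup.closure_mono (Set.image_mono h)

theorem parabolic_univ : parabolic Set.univ = ⊤ := by
  rw [parabolic, Set.image_univ]
  exact PresentedGroup.closure_range_of relators

@[elab_as_elim]
theorem parabolic_induction {T : Set Gen} {P : (x : Grp) → x ∈ parabolic T → Prop}
    (one : P 1 (one_mem _))
    (step : ∀ x s (η : ℤˣ) (hx : x ∈ parabolic T) (hs : s ∈ T), P x hx →
      P (x * gen s ^ (η : ℤ)) (mul_mem hx (gen_zpow_mem_parabolic hs _)))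
    {x : Grp} (hx : x ∈ parabolic T) : P x hx := by
  induction hx using Subgroup.closure_induction_right with
  | one => exact one
  | mul_right x hx y hy ih =>
    obtain ⟨s, hs, rfl⟩ := hy
    simpa using step x s 1 hx hs ih
  | mul_inv_cancel x hx y hy ih =>
    obtain ⟨s, hs, rfl⟩ := hy
    simpa using step x s (-1) hx hs ih

theorem apply_mul_of_mem_parabolic {α : Type*} {f : Grp → α} {T : Set Gen}
    (hf : ∀ v, ∀ t ∈ T, f (v * gen t) = f v) (v : Grp) {x : Grp} (hx : x ∈ parabolic T) :
    f (v * x) = f v := by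
  induction hx using parabolic_induction with
  | one => rw [mul_one]
  | step x t η _ ht ih =>
    rw [← mul_assoc, ← ih]
    rcases Int.units_eq_one_or η with rfl | rfl
    · simpa using hf (v * x) t ht
    · simpa using (hf (v * x * (gen t)⁻¹) t ht).symm

theorem vertex_induction {P : Grp → Prop} (u : Grp) (base : P u)
    (step : ∀ v s (η : ℤˣ), P v → P (v * gen s ^ (η : ℤ))) (v : Grp) : P v := by
  have hmem : u⁻¹ * v ∈ parabolic Set.univ := parabolic_univ ▸ Subgroup.mem_top _
  suffices P (u * (u⁻¹ * v)) by rwa [mul_inv_cancel_left] at this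
  generalize u⁻¹ * v = x at hmem ⊢
  induction hmem using parabolic_induction with
  | one => rwa [mul_one]
  | step x s η _ _ ih => rw [← mul_assoc]; exact step _ s η ih

open Classical in
/-- The exponent sum of the generator `s`. -/
def expo (s : Gen) : Grp →* Multiplicative ℤ :=
  liftHom (fun t => if t = s then Multiplicative.ofAdd 1 else 1) fun _ _ _ => Commute.all _ _

theorem expo_gen_zpow_self (s : Gen) (k : ℤ) : expo s (gen s ^ k) = Multiplicative.ofAdd k := by
  have hgen : expo s (gen s) = Multiplicative.ofAdd 1 := by rw [expo, liftHom_gen, if_pos rfl]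
  rw [map_zpow, hgen, ← ofAdd_zsmul, smul_eq_mul, mul_one]

theorem expo_of_mem_parabolic {T : Set Gen} {s : Gen} (hs : s ∉ T) {x : Grp}
    (hx : x ∈ parabolic T) : expo s x = 1 := by
  refine (Subgroup.closure_le (expo s).ker).2 ?_ hx
  rintro _ ⟨t, ht, rfl⟩
  have hts : t ≠ s := fun h => hs (h ▸ ht)
  simp [MonoidHom.mem_ker, expo, hts]

theorem expo_gen_zpow_of_ne {s t : Gen} (h : s ≠ t) (k : ℤ) : expo s (gen t ^ k) = 1 :=
  expo_of_mem_parabolic (T := {t}) h (gen_zpow_mem_parabolic (Set.mem_singleton t) k)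

theorem eq_zero_of_gen_zpow_mem_parabolic {T : Set Gen} {s : Gen} (hs : s ∉ T) {k : ℤ}
    (h : gen s ^ k ∈ parabolic T) : k = 0 := by
  simpa [expo_gen_zpow_self] using expo_of_mem_parabolic hs h

theorem gen_notMem_parabolic {T : Set Gen} {s : Gen} (hs : s ∉ T) : gen s ∉ parabolic T :=
  fun h => one_ne_zero (eq_zero_of_gen_zpow_mem_parabolic hs (k := 1) (by simpa using h))

theorem gen_zpow_inj {s : Gen} {k l : ℤ} : gen s ^ k = gen s ^ l ↔ k = l := by
  refine ⟨fun h => ?_, congrArg _⟩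
  simpa [expo_gen_zpow_self] using congrArg (expo s) h

theorem gen_zpow_units_inj {s t : Gen} {η θ : ℤˣ} :
    gen s ^ (η : ℤ) = gen t ^ (θ : ℤ) ↔ s = t ∧ η = θ := by
  refine ⟨fun h => ?_, by rintro ⟨rfl, rfl⟩; rfl⟩
  obtain rfl : s = t := by
    by_contra hne
    refine η.ne_zero (eq_zero_of_gen_zpow_mem_parabolic (T := {t}) hne ?_)
    exact h ▸ gen_zpow_mem_parabolic (Set.mem_singleton t) _
  exact ⟨rfl, Units.ext (gen_zpow_inj.1 h)⟩

theorem disjoint_parabolic {T T' : Set Gen} (h : Disjoint T T') :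
    Disjoint (parabolic T) (parabolic T') := by
  classical
  let retraction : Grp →* Grp := liftHom (fun s => if s ∈ T then gen s else 1) fun s t hst => by
    split_ifs
    exacts [commute_gen hst, Commute.one_right _, Commute.one_left _, Commute.one_left _]
  rw [Subgroup.disjoint_def]
  intro x hx hx'
  have hfix : retraction x = MonoidHom.id Grp x :=
    MonoidHom.eqOn_closure (by rintro _ ⟨s, hs, rfl⟩; simp [retraction, hs]) hx
  have hkill : retraction x = (1 : Grp →* Grp) x :=
    MonoidHom.eqOn_closure
      (by rintro _ ⟨s, hs, rfl⟩; simp [retraction, Set.disjoint_right.1 h hs]) hx'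
  exact hfix.symm.trans hkill

theorem isLetter_iff {s : Gen} {x : Grp} : IsLetter s x ↔ ∃ η : ℤˣ, x = gen s ^ (η : ℤ) := by
  constructor
  · rintro (rfl | rfl)
    exacts [⟨1, by simp⟩, ⟨-1, by simp⟩]
  · rintro ⟨η, rfl⟩
    rcases Int.units_eq_one_or η with rfl | rfl
    exacts [.inl (by simp), .inr (by simp)]

theorem isEdge_iff {v w : Grp} : IsEdge v w ↔ ∃ s, ∃ η : ℤˣ, w = v * gen s ^ (η : ℤ) := by
  simp only [IsEdge, isLetter_iff]
  constructor
  · rintro ⟨s, _, ⟨η, rfl⟩, rfl⟩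
    exact ⟨s, η, rfl⟩
  · rintro ⟨s, η, rfl⟩
    exact ⟨s, _, ⟨η, rfl⟩, rfl⟩

theorem isEdge_mul_gen_zpow (v : Grp) (s : Gen) (η : ℤˣ) : IsEdge v (v * gen s ^ (η : ℤ)) :=
  isEdge_iff.2 ⟨s, η, rfl⟩

theorem IsEdge.symm {v w : Grp} (h : IsEdge v w) : IsEdge w v := by
  obtain ⟨s, η, rfl⟩ := isEdge_iff.1 h
  exact isEdge_iff.2 ⟨s, -η, by simp⟩

theorem isSquareCell_iff {v w z u : Grp} : IsSquareCell v w z u ↔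
    ∃ s t, ∃ η θ : ℤˣ, Linked s t ∧ w = v * gen s ^ (η : ℤ) ∧
      z = v * gen s ^ (η : ℤ) * gen t ^ (θ : ℤ) ∧ u = v * gen t ^ (θ : ℤ) := by
  simp only [IsSquareCell, isLetter_iff]
  constructor
  · rintro ⟨s, t, _, _, hst, ⟨η, rfl⟩, ⟨θ, rfl⟩, hw, hz, hu⟩
    exact ⟨s, t, η, θ, hst, hw, hz, hu⟩
  · rintro ⟨s, t, η, θ, hst, hw, hz, hu⟩
    exact ⟨s, t, _, _, hst, ⟨η, rfl⟩, ⟨θ, rfl⟩, hw, hz, hu⟩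

theorem isSquareCell_of_linked {s t : Gen} (h : Linked s t) (v : Grp) (η θ : ℤˣ) :
    IsSquareCell v (v * gen s ^ (η : ℤ)) (v * gen s ^ (η : ℤ) * gen t ^ (θ : ℤ))
      (v * gen t ^ (θ : ℤ)) :=
  isSquareCell_iff.2 ⟨s, t, η, θ, h, rfl, rfl, rfl⟩

section Walk

variable {α : Type*} (F : Gen → Equiv.Perm α)
  (hF : ∀ s t, Linked s t → Commute (F s) (F t)) (a : α)

/-- The endpoint of the path in `α` that starts at `a` and follows a word for `v`, where the
letter `s` moves by `F s`. -/
def walk (v : Grp) : α :=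
  (liftHom (fun s => MulOpposite.op (F s)) (fun s t h => (hF s t h).op) v).unop a

@[simp] theorem walk_one : walk F hF a 1 = a := by simp [walk]

theorem walk_mul_gen (v : Grp) (s : Gen) : walk F hF a (v * gen s) = F s (walk F hF a v) := by
  simp [walk]

variable {F}

theorem eq_of_forall_mul_gen {f f' : Grp → α} (hf : ∀ v s, f (v * gen s) = F s (f v))
    (hf' : ∀ v s, f' (v * gen s) = F s (f' v)) {u : Grp} (hu : f u = f' u) : f = f' := by
  funext v
  induction v using vertex_induction u with
  | base => exact hu
  | step v s η ih =>
    rcases Int.units_eq_one_or η with rfl | rfl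
    · simp [hf, hf', ih]
    · refine (F s).injective ?_
      simpa [← hf, ← hf'] using ih

end Walk

/-- The labels `t` such that the lines of label `t` through a vertex cross the hyperplane dual to
the edge of label `s` at that vertex. -/
def labelLink (s : Gen) : Set Gen := {t | Linked s t}

/-- The label `s` together with its link. -/
def labelStar (s : Gen) : Set Gen := insert s (labelLink s)

/-- A permutation of the vertices that carries each edge of `X` to an edge with the same label. -/
def Labelled (σ : Equiv.Perm Grp) : Prop :=
  ∀ v s, ∃ ε : ℤˣ, σ (v * gen s) = σ v * gen s ^ (ε : ℤ)

open Classical in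
/-- The sign with which `σ` acts on the line of label `s` through `v`. -/
def sgn (σ : Equiv.Perm Grp) (s : Gen) (v : Grp) : ℤˣ :=
  if σ (v * gen s) = σ v * gen s then 1 else -1

theorem sgn_eq {σ : Equiv.Perm Grp} {s : Gen} {v : Grp} {ε : ℤˣ}
    (h : σ (v * gen s) = σ v * gen s ^ (ε : ℤ)) : sgn σ s v = ε := by
  have hne : (gen s)⁻¹ ≠ gen s := fun h => by
    have := gen_zpow_inj (s := s) (k := -1) (l := 1)
    simp [h] at this
  rcases Int.units_eq_one_or ε with rfl | rfl <;> simp [sgn, h, hne]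

@[simp] theorem sgn_mulLeft (x : Grp) (s : Gen) (v : Grp) : sgn (Equiv.mulLeft x) s v = 1 :=
  sgn_eq (by simp [mul_assoc])

theorem labelled_mulLeft (x : Grp) : Labelled (Equiv.mulLeft x) :=
  fun _ _ => ⟨1, by simp [mul_assoc]⟩

namespace Labelled

variable {σ τ : Equiv.Perm Grp}

theorem map_mul_gen (hσ : Labelled σ) (v : Grp) (s : Gen) :
    σ (v * gen s) = σ v * gen s ^ (sgn σ s v : ℤ) := by
  obtain ⟨ε, hε⟩ := hσ v s
  rw [sgn_eq hε, hε]

theorem sgn_mul_gen_self (hσ : Labelled σ) (v : Grp) (s : Gen) :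
    sgn σ s (v * gen s) = sgn σ s v := by
  by_contra hne
  have hneg : sgn σ s (v * gen s) = -sgn σ s v := by
    rcases Int.units_eq_one_or (sgn σ s (v * gen s)) with h | h <;>
      rcases Int.units_eq_one_or (sgn σ s v) with h' | h' <;> simp_all
  have hback : σ (v * gen s * gen s) = σ v := by
    rw [hσ.map_mul_gen, hσ.map_mul_gen, hneg]; simp
  have htwo : gen s ^ (2 : ℤ) = gen s ^ (0 : ℤ) := by
    have h := σ.injective hback
    rwa [mul_assoc, mul_eq_left, ← zpow_two, ← zpow_zero (gen s)] at h
  simpa using gen_zpow_inj.1 htwo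

theorem map_mul_gen_zpow (hσ : Labelled σ) (v : Grp) (s : Gen) (η : ℤˣ) :
    σ (v * gen s ^ (η : ℤ)) = σ v * gen s ^ ((sgn σ s v * η : ℤˣ) : ℤ) := by
  rcases Int.units_eq_one_or η with rfl | rfl
  · simpa using hσ.map_mul_gen v s
  · have h := hσ.map_mul_gen (v * (gen s)⁻¹) s
    have hs := hσ.sgn_mul_gen_self (v * (gen s)⁻¹) s
    rw [inv_mul_cancel_right] at h hs
    simp [h, hs]

theorem sgn_mul_gen_of_linked (hσ : Labelled σ) {s t : Gen} (h : Linked s t) (v : Grp) :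
    sgn σ s (v * gen t) = sgn σ s v := by
  have hcomm : σ (v * gen s * gen t) = σ (v * gen t * gen s) := by
    rw [mul_assoc, (commute_gen h).eq, ← mul_assoc]
  simp only [hσ.map_mul_gen] at hcomm
  rw [mul_assoc, mul_assoc, mul_right_inj] at hcomm
  have hexpo := congrArg (expo s) hcomm
  simp only [map_mul, expo_gen_zpow_self, expo_gen_zpow_of_ne h.ne, mul_one, one_mul] at hexpo
  exact (Units.ext (Multiplicative.ofAdd.injective hexpo)).symm

theorem sgn_mul_of_mem_star (hσ : Labelled σ) {s : Gen} (v : Grp) {x : Grp}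
    (hx : x ∈ parabolic (labelStar s)) : sgn σ s (v * x) = sgn σ s v := by
  refine apply_mul_of_mem_parabolic (fun w t ht => ?_) v hx
  rcases ht with rfl | ht
  exacts [hσ.sgn_mul_gen_self w t, hσ.sgn_mul_gen_of_linked ht w]

theorem sgn_mul (hσ : Labelled σ) (hτ : Labelled τ) (s : Gen) (v : Grp) :
    sgn (σ * τ) s v = sgn σ s (τ v) * sgn τ s v :=
  sgn_eq (by simp only [Equiv.Perm.mul_apply, hτ.map_mul_gen, hσ.map_mul_gen_zpow])

theorem one : Labelled 1 := fun _ _ => ⟨1, by simp⟩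

theorem mul (hσ : Labelled σ) (hτ : Labelled τ) : Labelled (σ * τ) := fun v s =>
  ⟨sgn σ s (τ v) * sgn τ s v, by
    simp only [Equiv.Perm.mul_apply, hτ.map_mul_gen, hσ.map_mul_gen_zpow]⟩

theorem inv (hσ : Labelled σ) : Labelled σ⁻¹ := fun v s =>
  ⟨sgn σ s (σ⁻¹ v), by rw [Equiv.Perm.inv_eq_iff_eq, hσ.map_mul_gen_zpow]; simp⟩

theorem pow (hσ : Labelled σ) (n : ℕ) : Labelled (σ ^ n) := by
  induction n with
  | zero => exact one
  | succ n ih => rw [pow_succ]; exact ih.mul hσ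

theorem ext_of_sgn (hσ : Labelled σ) (hτ : Labelled τ) {u : Grp} (hu : σ u = τ u)
    (h : ∀ s v, sgn σ s v = sgn τ s v) : σ = τ := by
  ext v
  induction v using vertex_induction u with
  | base => exact hu
  | step v s η ih => rw [hσ.map_mul_gen_zpow, hτ.map_mul_gen_zpow, ih, h]

theorem inv_mul_map_mem_parabolic (hσ : Labelled σ) {T : Set Gen} {u v : Grp}
    (h : u⁻¹ * v ∈ parabolic T) : (σ u)⁻¹ * σ v ∈ parabolic T := by
  suffices ∀ x ∈ parabolic T, (σ u)⁻¹ * σ (u * x) ∈ parabolic T by simpa using this _ h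
  intro x hx
  induction hx using parabolic_induction with
  | one => simp
  | step x s η _ hs ih =>
    rw [← mul_assoc, hσ.map_mul_gen_zpow, ← mul_assoc]
    exact mul_mem ih (gen_zpow_mem_parabolic hs _)

theorem inv_mul_map_mem_parabolic_iff (hσ : Labelled σ) {T : Set Gen} {u v : Grp} :
    (σ u)⁻¹ * σ v ∈ parabolic T ↔ u⁻¹ * v ∈ parabolic T :=
  ⟨fun h => by simpa using hσ.inv.inv_mul_map_mem_parabolic h, hσ.inv_mul_map_mem_parabolic⟩

theorem isEdge (hσ : Labelled σ) {v w : Grp} (h : IsEdge v w) : IsEdge (σ v) (σ w) := by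
  obtain ⟨s, η, rfl⟩ := isEdge_iff.1 h
  exact isEdge_iff.2 ⟨s, _, hσ.map_mul_gen_zpow v s η⟩

theorem isSquareCell (hσ : Labelled σ) {v w z u : Grp} (h : IsSquareCell v w z u) :
    IsSquareCell (σ v) (σ w) (σ z) (σ u) := by
  obtain ⟨s, t, η, θ, hst, rfl, rfl, rfl⟩ := isSquareCell_iff.1 h
  have hsgn : sgn σ t (v * gen s ^ (η : ℤ)) = sgn σ t v :=
    hσ.sgn_mul_of_mem_star v (gen_zpow_mem_parabolic (.inr hst.symm) _)
  refine isSquareCell_iff.2 ⟨s, t, sgn σ s v * η, sgn σ t v * θ, hst, ?_, ?_, ?_⟩ <;>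
    simp only [hσ.map_mul_gen_zpow, hsgn]

/-- The automorphism of `X` with a given labelled vertex permutation. -/
def toAut (hσ : Labelled σ) : Aut :=
  ⟨σ, fun _ _ => ⟨fun h => by simpa using hσ.inv.isEdge h, hσ.isEdge⟩,
    fun _ _ _ _ => ⟨fun h => by simpa using hσ.inv.isSquareCell h, hσ.isSquareCell⟩⟩

@[simp] theorem toPerm_toAut (hσ : Labelled σ) : hσ.toAut.toPerm = σ := rfl

end Labelled

@[simp] theorem Aut.toPerm_mul (g h : Aut) : (g * h).toPerm = g.toPerm * h.toPerm := rfl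

@[simp] theorem Aut.toPerm_one : (1 : Aut).toPerm = 1 := rfl

@[simp] theorem Aut.toPerm_inv (g : Aut) : (g⁻¹).toPerm = g.toPerm⁻¹ := rfl

theorem Aut.toPerm_injective : Function.Injective Aut.toPerm := Subtype.val_injective

/-- The families of signs, one for each line of `X`, that agree on parallel lines; the line of label
`s` through `v` has the sign `e s v`. -/
def signData : Set (Gen → Grp → ℤˣ) :=
  {e | ∀ s v, ∀ x ∈ parabolic (labelStar s), e s (v * x) = e s v}

theorem Labelled.sgn_mem_signData {σ : Equiv.Perm Grp} (hσ : Labelled σ) : sgn σ ∈ signData :=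
  fun _ v _ hx => hσ.sgn_mul_of_mem_star v hx

section Twist

variable {e : Gen → Grp → ℤˣ}

/-- One step along the line of label `s`, in the direction of its sign. -/
def twistStep (he : e ∈ signData) (s : Gen) : Equiv.Perm Grp where
  toFun v := v * gen s ^ (e s v : ℤ)
  invFun v := v * gen s ^ (-(e s v : ℤ))
  left_inv v := by
    simp [he s v _ (gen_zpow_mem_parabolic (.inl rfl) _)]
  right_inv v := by
    simp only [he s v _ (gen_zpow_mem_parabolic (.inl rfl) _)]; simp

theorem commute_twistStep (he : e ∈ signData) {s t : Gen} (h : Linked s t) :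
    Commute (twistStep he s) (twistStep he t) := by
  ext v
  have hs := he s v _ (gen_zpow_mem_parabolic (.inr h) (e t v))
  have ht := he t v _ (gen_zpow_mem_parabolic (.inr h.symm) (e s v))
  simp only [twistStep, Equiv.Perm.mul_apply, Equiv.coe_fn_mk, hs, ht, mul_assoc]
  rw [((commute_gen h).zpow_zpow _ _).eq]

/-- The map that fixes `1` and steps from the image of `v` along the sign of the line through that
image. It is the inverse of the permutation with signs `e`. -/
def twist (he : e ∈ signData) : Grp → Grp :=
  walk (twistStep he) (fun _ _ => commute_twistStep he) 1

@[simp] theorem twist_one (he : e ∈ signData) : twist he 1 = 1 := walk_one _ _ _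

theorem twist_mul_gen (he : e ∈ signData) (v : Grp) (s : Gen) :
    twist he (v * gen s) = twist he v * gen s ^ (e s (twist he v) : ℤ) :=
  walk_mul_gen _ _ _ v s

theorem twist_mul_gen_zpow (he : e ∈ signData) (v : Grp) (s : Gen) (η : ℤˣ) :
    twist he (v * gen s ^ (η : ℤ)) =
      twist he v * gen s ^ ((e s (twist he v) * η : ℤˣ) : ℤ) := by
  rcases Int.units_eq_one_or η with rfl | rfl
  · simpa using twist_mul_gen he v s
  · have h := twist_mul_gen he (v * (gen s)⁻¹) s
    rw [inv_mul_cancel_right] at h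
    have hsign : e s (twist he v) = e s (twist he (v * (gen s)⁻¹)) := by
      rw [h, he s _ _ (gen_zpow_mem_parabolic (.inl rfl) _)]
    rw [hsign, h]
    simp

theorem comp_twist_mem_signData (he : e ∈ signData) :
    (fun s v => e s (twist he v)) ∈ signData := by
  intro s v x hx
  dsimp only
  induction hx using parabolic_induction with
  | one => simp
  | step x t η _ ht ih =>
    rw [← mul_assoc, twist_mul_gen_zpow, he s _ _ (gen_zpow_mem_parabolic ht _), ih]

theorem twist_twist (he : e ∈ signData) :
    twist he ∘ twist (comp_twist_mem_signData he) = id := by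
  refine eq_of_forall_mul_gen (F := fun s => Equiv.mulRight (gen s)) (u := 1) (fun v s => ?_)
    (fun _ _ => rfl) (by simp)
  simp [twist_mul_gen, twist_mul_gen_zpow]

-- Every twist has a right inverse that is again a twist, so the right inverse is two-sided.
theorem twist_bijective (he : e ∈ signData) : Function.Bijective (twist he) := by
  have hright := twist_twist he
  have hright' := twist_twist (comp_twist_mem_signData he)
  refine Function.bijective_iff_has_inverse.2
    ⟨twist (comp_twist_mem_signData he), congrFun ?_, congrFun hright⟩
  rwa [show twist (comp_twist_mem_signData (comp_twist_mem_signData he)) = twist he from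
    (congrArg (· ∘ _) hright.symm).trans (congrArg (twist he ∘ ·) hright')] at hright'

/-- The permutation of the vertices that fixes `1` and acts on the lines with the signs `e`. -/
def signPerm (he : e ∈ signData) : Equiv.Perm Grp := (Equiv.ofBijective _ (twist_bijective he)).symm

@[simp] theorem signPerm_one (he : e ∈ signData) : signPerm he 1 = 1 := by
  rw [signPerm, Equiv.symm_apply_eq]; simp

theorem signPerm_mul_gen_zpow (he : e ∈ signData) (v : Grp) (s : Gen) (η : ℤˣ) :
    signPerm he (v * gen s ^ (η : ℤ)) = signPerm he v * gen s ^ ((e s v * η : ℤˣ) : ℤ) := by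
  have htwist : twist he (signPerm he v) = v :=
    (Equiv.ofBijective _ (twist_bijective he)).apply_symm_apply v
  rw [signPerm, Equiv.symm_apply_eq, Equiv.ofBijective_apply, ← signPerm, twist_mul_gen_zpow,
    htwist, ← mul_assoc, Int.units_mul_self, one_mul]

theorem signPerm_mul_gen (he : e ∈ signData) (v : Grp) (s : Gen) :
    signPerm he (v * gen s) = signPerm he v * gen s ^ (e s v : ℤ) := by
  simpa using signPerm_mul_gen_zpow he v s 1

theorem labelled_signPerm (he : e ∈ signData) : Labelled (signPerm he) :=
  fun v s => ⟨e s v, signPerm_mul_gen he v s⟩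

theorem sgn_signPerm (he : e ∈ signData) : sgn (signPerm he) = e :=
  funext₂ fun s v => sgn_eq (signPerm_mul_gen he v s)

end Twist

theorem labelLink_subset_labelStar (s : Gen) : labelLink s ⊆ labelStar s := Set.subset_insert _ _

theorem labelLink_subset_compl (s : Gen) : labelLink s ⊆ {s}ᶜ := fun _ ht => ht.ne.symm

section LineFlip

open Classical in
/-- The signs that are negative exactly on the lines parallel to the line of label `s`
through `u`. -/
def flipData (s : Gen) (u : Grp) (t : Gen) (v : Grp) : ℤˣ :=
  if t = s ∧ u⁻¹ * v ∈ parabolic (labelStar s) then -1 else 1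

theorem flipData_mem_signData (s : Gen) (u : Grp) : flipData s u ∈ signData := by
  intro t v x hx
  unfold flipData
  congr 1
  refine propext (and_congr_right ?_)
  rintro rfl
  rw [← mul_assoc, Subgroup.mul_mem_cancel_right _ hx]

/-- The automorphism that fixes `u` and reverses the lines parallel to the line of label `s`
through `u`. -/
def lineFlip (s : Gen) (u : Grp) : Equiv.Perm Grp :=
  Equiv.mulLeft (u * (signPerm (flipData_mem_signData s u) u)⁻¹) *
    signPerm (flipData_mem_signData s u)

@[simp] theorem lineFlip_self (s : Gen) (u : Grp) : lineFlip s u u = u := by simp [lineFlip]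

theorem labelled_lineFlip (s : Gen) (u : Grp) : Labelled (lineFlip s u) :=
  (labelled_mulLeft _).mul (labelled_signPerm _)

theorem sgn_lineFlip (s : Gen) (u : Grp) : sgn (lineFlip s u) = flipData s u := by
  ext1 t
  ext1 v
  rw [lineFlip, (labelled_mulLeft _).sgn_mul (labelled_signPerm _), sgn_mulLeft, sgn_signPerm,
    one_mul]

theorem sgn_lineFlip_self (s : Gen) (u : Grp) : sgn (lineFlip s u) s u = -1 := by
  simp [sgn_lineFlip, flipData, one_mem]

theorem sgn_lineFlip_of_ne {s t : Gen} (h : t ≠ s) (u v : Grp) : sgn (lineFlip s u) t v = 1 := by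
  simp [sgn_lineFlip, flipData, h]

end LineFlip

section FarSide

theorem commute_of_mem_link {s : Gen} {x : Grp} (hx : x ∈ parabolic (labelLink s)) (k : ℤ) :
    Commute x (gen s ^ k) := by
  induction hx using parabolic_induction with
  | one => exact Commute.one_left _
  | step x t η _ ht ih => exact ih.mul_left ((commute_gen ht.symm).zpow_zpow _ _)

theorem gen_zpow_mul_mem_link_iff {s : Gen} {x : Grp} (k : ℤ) :
    gen s ^ k * x ∈ parabolic (labelLink s) ↔ x * gen s ^ k ∈ parabolic (labelLink s) := by
  have hconj : gen s ^ k * (x * gen s ^ k) = gen s ^ k * x * gen s ^ k := (mul_assoc _ _ _).symm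
  constructor <;> intro h
  · rwa [mul_left_cancel (hconj.trans (commute_of_mem_link h k).eq)]
  · rwa [← mul_right_cancel ((commute_of_mem_link h k).eq.trans hconj)]

open Classical in
/-- One step of label `t`, where the second entry records the side of the hyperplane dual to the
edge from `1` to `gen s`. -/
def wallStep (s t : Gen) : Equiv.Perm (Grp × Bool) where
  toFun p := (p.1 * gen t, p.2 ^^ decide (t = s ∧ p.1 ∈ parabolic (labelLink s)))
  invFun p :=
    (p.1 * (gen t)⁻¹, p.2 ^^ decide (t = s ∧ p.1 * (gen t)⁻¹ ∈ parabolic (labelLink s)))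
  left_inv p := by simp
  right_inv p := by simp

theorem commute_wallStep (s : Gen) {t t' : Gen} (h : Linked t t') :
    Commute (wallStep s t) (wallStep s t') := by
  have hlink : ∀ {r r'}, Linked r r' → ∀ v,
      (v * gen r' ∈ parabolic (labelLink r) ↔ v ∈ parabolic (labelLink r)) := fun h v =>
    Subgroup.mul_mem_cancel_right _ (gen_mem_parabolic h)
  ext p
  · simp [wallStep, mul_assoc, (commute_gen h).eq]
  · by_cases ht : t = s
    · subst ht
      simp [wallStep, hlink h, h.ne.symm]
    · by_cases ht' : t' = s
      · subst ht'
        simp [wallStep, hlink h.symm, ht]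
      · simp [wallStep, ht, ht']

/-- The side of the hyperplane dual to the edge from `1` to `gen s` on which `v` lies. -/
def wallSide (s : Gen) (v : Grp) : Bool :=
  (walk (wallStep s) (fun _ _ => commute_wallStep s) (1, false) v).2

open Classical in
theorem wallSide_mul_gen (s : Gen) (v : Grp) (t : Gen) :
    wallSide s (v * gen t) =
      (wallSide s v ^^ decide (t = s ∧ v ∈ parabolic (labelLink s))) := by
  have hfst : (fun v => (walk (wallStep s) (fun _ _ => commute_wallStep s) (1, false) v).1) = id :=
    eq_of_forall_mul_gen (F := fun t => Equiv.mulRight (gen t)) (u := 1)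
      (fun v t => by simp [walk_mul_gen, wallStep]) (fun _ _ => rfl) (by simp)
  rw [wallSide, walk_mul_gen, wallStep, Equiv.coe_fn_mk]
  simp only [congrFun hfst v, id]
  rfl

theorem wallSide_of_mem_link {s : Gen} {v : Grp} (hv : v ∈ parabolic (labelLink s)) :
    wallSide s v = false := by
  have hconst := apply_mul_of_mem_parabolic (f := wallSide s) (T := {s}ᶜ)
    (fun w t ht => by simp [wallSide_mul_gen, show t ≠ s from ht]) 1
    (parabolic_mono (labelLink_subset_compl s) hv)
  simpa [wallSide] using hconst

/-- `S` is the set of the vertices beyond the hyperplane dual to the edge of label `s` from `u` to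
`u * gen s ^ ε`: the edges that enter `S` are exactly those parallel to this one. -/
def IsFarSide (S : Set Grp) (s : Gen) (u : Grp) (ε : ℤˣ) : Prop :=
  ∀ v t (η : ℤˣ), (v ∉ S ∧ v * gen t ^ (η : ℤ) ∈ S) ↔
    t = s ∧ η = ε ∧ u⁻¹ * v ∈ parabolic (labelLink s)

theorem isFarSide_wallSide (s : Gen) : IsFarSide {v | wallSide s v = true} s 1 1 := by
  classical
  intro v t η
  rcases Int.units_eq_one_or η with rfl | rfl
  · simp only [Set.mem_ofPred_eq, Units.val_one, zpow_one, wallSide_mul_gen, inv_one, one_mul,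
      true_and, Bool.not_eq_true]
    constructor
    · rintro ⟨hv, hcross⟩
      simpa [hv] using hcross
    · rintro ⟨rfl, hlink⟩
      simp [wallSide_of_mem_link hlink, hlink]
  · have hback := wallSide_mul_gen s (v * (gen t)⁻¹) t
    rw [inv_mul_cancel_right] at hback
    suffices ¬(wallSide s v ≠ true ∧ wallSide s (v * (gen t)⁻¹) = true) by simpa using this
    rintro ⟨hv, hw⟩
    rw [hw, Bool.eq_false_iff.2 hv, Bool.true_xor, eq_comm, Bool.not_eq_false',
      decide_eq_true_iff] at hback
    rw [wallSide_of_mem_link hback.2] at hw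
    contradiction

namespace IsFarSide

variable {S S' : Set Grp} {s : Gen} {u u' : Grp} {ε ε' : ℤˣ}

theorem notMem (h : IsFarSide S s u ε) : u ∉ S :=
  ((h u s ε).2 ⟨rfl, rfl, by simp [one_mem]⟩).1

theorem compl (h : IsFarSide S s u ε) : IsFarSide Sᶜ s (u * gen s ^ (ε : ℤ)) (-ε) := by
  intro v t η
  have hback := h (v * gen t ^ (η : ℤ)) t (-η)
  rw [Units.val_neg, zpow_neg, mul_inv_cancel_right, and_comm] at hback
  rw [Set.notMem_compl_iff, Set.mem_compl_iff, hback, neg_eq_iff_eq_neg]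
  refine and_congr_right ?_
  rintro rfl
  refine and_congr_right ?_
  rintro rfl
  rw [← mul_assoc, ← gen_zpow_mul_mem_link_iff]
  simp [mul_assoc]

theorem mem_iff_of_ne (h : IsFarSide S s u ε) (v : Grp) {t : Gen} (ht : t ≠ s) (η : ℤˣ) :
    v * gen t ^ (η : ℤ) ∈ S ↔ v ∈ S := by
  have henter := h v t η
  have hleave := h.compl v t η
  simp only [ht, false_and, iff_false, Set.mem_compl_iff] at henter hleave
  tauto

theorem mul_mem_iff (h : IsFarSide S s u ε) (v : Grp) {x : Grp} (hx : x ∈ parabolic {s}ᶜ) :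
    v * x ∈ S ↔ v ∈ S :=
  iff_of_eq (apply_mul_of_mem_parabolic (f := (· ∈ S))
    (fun w t ht => propext (by simpa using h.mem_iff_of_ne w ht 1)) v hx)

theorem mem_iff_of_mem_link (h : IsFarSide S s u ε) {v w : Grp}
    (hvw : v⁻¹ * w ∈ parabolic (labelLink s)) : w ∈ S ↔ v ∈ S := by
  simpa using h.mul_mem_iff v (parabolic_mono (labelLink_subset_compl s) hvw)

theorem congr_base (h : IsFarSide S s u ε) (hu : u⁻¹ * u' ∈ parabolic (labelLink s)) :
    IsFarSide S s u' ε := by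
  intro v t η
  rw [h v t η, ← Subgroup.mul_mem_cancel_left _ hu (y := u'⁻¹ * v), mul_assoc,
    mul_inv_cancel_left]

theorem unique (h : IsFarSide S s u ε) (h' : IsFarSide S' s u ε) : S = S' := by
  ext v
  induction v using vertex_induction u with
  | base => simp [h.notMem, h'.notMem]
  | step v t η ih =>
    have henter := (h v t η).trans (h' v t η).symm
    have hleave := (h.compl v t η).trans (h'.compl v t η).symm
    simp only [Set.mem_compl_iff] at hleave
    tauto

theorem disjoint (h : IsFarSide S s u ε) (h' : IsFarSide S' s u' ε') (hu : u ∉ S') (hu' : u' ∉ S)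
    (hne : ¬(u⁻¹ * u' ∈ parabolic (labelLink s) ∧ ε = ε')) : Disjoint S S' := by
  suffices ∀ v, ¬(v ∈ S ∧ v ∈ S') from Set.disjoint_left.2 fun v hv hv' => this v ⟨hv, hv'⟩
  intro v
  induction v using vertex_induction u with
  | base => exact fun hm => hu hm.2
  | step v t η ih =>
    rintro ⟨hmem, hmem'⟩
    by_cases hv : v ∈ S
    · obtain ⟨-, -, hlink'⟩ := (h' v t η).1 ⟨fun hv' => ih ⟨hv, hv'⟩, hmem'⟩
      exact hu' ((h.mem_iff_of_mem_link hlink').1 hv)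
    · obtain ⟨rfl, rfl, hlink⟩ := (h v t η).1 ⟨hv, hmem⟩
      obtain ⟨-, hε, hlink'⟩ :=
        (h' v t η).1 ⟨fun hv' => hu ((h'.mem_iff_of_mem_link hlink).1 hv'), hmem'⟩
      exact hne ⟨by simpa [mul_assoc] using mul_mem hlink (inv_mem hlink'), hε⟩

theorem image (h : IsFarSide S s u ε) {σ : Equiv.Perm Grp} (hσ : Labelled σ) :
    IsFarSide (σ '' S) s (σ u) (sgn σ s u * ε) := by
  intro v t η
  obtain ⟨w, rfl⟩ := σ.surjective v
  have hmap : σ w * gen t ^ (η : ℤ) = σ (w * gen t ^ ((sgn σ t w * η : ℤˣ) : ℤ)) := by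
    rw [hσ.map_mul_gen_zpow, ← mul_assoc, Int.units_mul_self, one_mul]
  rw [hmap, σ.injective.mem_set_image, σ.injective.mem_set_image, h,
    hσ.inv_mul_map_mem_parabolic_iff]
  refine and_congr_right ?_
  rintro rfl
  refine and_congr_left fun hlink => ?_
  have hsgn := hσ.sgn_mul_of_mem_star u (parabolic_mono (labelLink_subset_labelStar t) hlink)
  rw [mul_inv_cancel_left] at hsgn
  rw [hsgn, ← inv_mul_eq_iff_eq_mul, inv_eq_of_mul_eq_one_right (Int.units_mul_self _)]

end IsFarSide

theorem exists_isFarSide (s : Gen) (u : Grp) (ε : ℤˣ) : ∃ S, IsFarSide S s u ε := by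
  rcases Int.units_eq_one_or ε with rfl | rfl
  · exact ⟨_, by simpa using (isFarSide_wallSide s).image (labelled_mulLeft u)⟩
  · have h := (isFarSide_wallSide s).compl.image (labelled_mulLeft (u * (gen s)⁻¹))
    rw [sgn_mulLeft, Equiv.coe_mulLeft] at h
    exact ⟨_, by simpa using h⟩

/-- The vertices beyond the hyperplane dual to the edge of label `s` from `u` to
`u * gen s ^ ε`. -/
def farSide (s : Gen) (u : Grp) (ε : ℤˣ) : Set Grp := (exists_isFarSide s u ε).choose

theorem isFarSide_farSide (s : Gen) (u : Grp) (ε : ℤˣ) : IsFarSide (farSide s u ε) s u ε :=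
  (exists_isFarSide s u ε).choose_spec

theorem compl_farSide (s : Gen) (u : Grp) (ε : ℤˣ) :
    (farSide s u ε)ᶜ = farSide s (u * gen s ^ (ε : ℤ)) (-ε) :=
  (isFarSide_farSide s u ε).compl.unique (isFarSide_farSide _ _ _)

theorem Labelled.image_farSide {σ : Equiv.Perm Grp} (hσ : Labelled σ) (s : Gen) (u : Grp)
    (ε : ℤˣ) : σ '' farSide s u ε = farSide s (σ u) (sgn σ s u * ε) :=
  ((isFarSide_farSide s u ε).image hσ).unique (isFarSide_farSide _ _ _)

end FarSide

theorem disjoint_farSide_neg (s : Gen) (u : Grp) (ε : ℤˣ) :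
    Disjoint (farSide s u ε) (farSide s u (-ε)) :=
  (isFarSide_farSide s u ε).disjoint (isFarSide_farSide s u (-ε)) (isFarSide_farSide _ _ _).notMem
    (isFarSide_farSide _ _ _).notMem fun h => units_ne_neg_self ε h.2

theorem IsFarSide.map_eq_of_isEdge {S : Set Grp} {s : Gen} {u : Grp} {ε : ℤˣ}
    (h : IsFarSide S s u ε) {σ : Equiv.Perm Grp} (hσ : Labelled σ) (hfix : ∀ v ∉ S, σ v = v)
    {v w : Grp} (hv : v ∉ S) (hvw : IsEdge v w) : σ w = w := by
  by_cases hw : w ∉ S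
  · exact hfix w hw
  obtain ⟨t, η, rfl⟩ := isEdge_iff.1 hvw
  obtain ⟨rfl, rfl, -⟩ := (h v t η).1 ⟨hv, not_not.1 hw⟩
  have hopp : v * gen t ^ ((-η : ℤˣ) : ℤ) ∉ S := fun hmem =>
    neg_units_ne_self η ((h v t (-η)).1 ⟨hv, hmem⟩).2.1
  have hmap := hσ.map_mul_gen_zpow v t (-η)
  rw [hfix _ hopp, hfix v hv, mul_right_inj, gen_zpow_units_inj, eq_comm (a := -η), mul_eq_right]
    at hmap
  rw [hσ.map_mul_gen_zpow, hfix v hv, hmap.2, one_mul]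

/-- The labelled automorphisms supported in `S`. -/
def rigidStabilizer (S : Set Grp) : Subgroup Aut where
  carrier := {g | Labelled g.toPerm ∧ ∀ v ∉ S, g.toPerm v = v}
  one_mem' := ⟨.one, fun _ _ => rfl⟩
  mul_mem' hg hh := ⟨hg.1.mul hh.1, fun v hv => by
    rw [Aut.toPerm_mul, Equiv.Perm.mul_apply, hh.2 v hv, hg.2 v hv]⟩
  inv_mem' hg := ⟨hg.1.inv, fun v hv => by
    rw [Aut.toPerm_inv, Equiv.Perm.inv_eq_iff_eq, hg.2 v hv]⟩

theorem rigidStabilizer_mono {S T : Set Grp} (h : S ⊆ T) :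
    rigidStabilizer S ≤ rigidStabilizer T :=
  fun _ hg => ⟨hg.1, fun v hv => hg.2 v fun hmem => hv (h hmem)⟩

theorem conj_mem_rigidStabilizer {S : Set Grp} {g r : Aut} (hg : Labelled g.toPerm)
    (hr : r ∈ rigidStabilizer S) : g * r * g⁻¹ ∈ rigidStabilizer (g.toPerm '' S) := by
  refine ⟨(hg.mul hr.1).mul hg.inv, fun v hv => ?_⟩
  have hfix : r.toPerm (g.toPerm⁻¹ v) = g.toPerm⁻¹ v :=
    hr.2 _ fun hmem => hv ⟨_, hmem, g.toPerm.apply_symm_apply v⟩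
  rw [Aut.toPerm_mul, Aut.toPerm_mul, Aut.toPerm_inv, Equiv.Perm.mul_apply,
    Equiv.Perm.mul_apply, hfix, ← Equiv.Perm.mul_apply, mul_inv_cancel,
    Equiv.Perm.one_apply]

section Cut

variable {σ : Equiv.Perm Grp} {S : Set Grp} [DecidablePred (· ∈ S)]

theorem Labelled.ofSubtype_subtypePerm (hσ : Labelled σ) (hS : ∀ v, σ v ∈ S ↔ v ∈ S)
    (hboundary : ∀ v w, IsEdge v w → v ∈ S → w ∉ S → σ v = v) :
    Labelled (Equiv.Perm.ofSubtype (σ.subtypePerm hS)) := by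
  have hmem : ∀ v ∈ S, Equiv.Perm.ofSubtype (σ.subtypePerm hS) v = σ v := fun v hv =>
    Equiv.Perm.ofSubtype_apply_of_mem _ hv
  have hnotMem : ∀ v ∉ S, Equiv.Perm.ofSubtype (σ.subtypePerm hS) v = v := fun v hv =>
    Equiv.Perm.ofSubtype_apply_of_not_mem _ hv
  intro v s
  have hedge : IsEdge v (v * gen s) := by simpa using isEdge_mul_gen_zpow v s 1
  by_cases hv : v ∈ S <;> by_cases hw : v * gen s ∈ S
  · exact ⟨sgn σ s v, by rw [hmem _ hv, hmem _ hw, hσ.map_mul_gen]⟩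
  · exact ⟨1, by rw [hmem _ hv, hnotMem _ hw, hboundary _ _ hedge hv hw]; simp⟩
  · exact ⟨1, by rw [hnotMem _ hv, hmem _ hw, hboundary _ _ hedge.symm hw hv]; simp⟩
  · exact ⟨1, by rw [hnotMem _ hv, hnotMem _ hw]; simp⟩

end Cut

theorem mem_rigidStabilizer_sup {g : Aut} (hg : Labelled g.toPerm) {S : Set Grp}
    (hS : ∀ v, g.toPerm v ∈ S ↔ v ∈ S)
    (hboundary : ∀ v w, IsEdge v w → v ∈ S → w ∉ S → g.toPerm v = v) :
    g ∈ rigidStabilizer S ⊔ rigidStabilizer Sᶜ := by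
  classical
  have hcut := hg.ofSubtype_subtypePerm hS hboundary
  have hcut_mem : hcut.toAut ∈ rigidStabilizer S :=
    ⟨hcut, fun v hv => Equiv.Perm.ofSubtype_apply_of_not_mem _ hv⟩
  have hrest_mem : hcut.toAut⁻¹ * g ∈ rigidStabilizer Sᶜ := by
    refine ⟨hcut.inv.mul hg, fun v hv => ?_⟩
    rw [Aut.toPerm_mul, Aut.toPerm_inv, Labelled.toPerm_toAut, Equiv.Perm.mul_apply,
      Equiv.Perm.inv_eq_iff_eq, Equiv.Perm.ofSubtype_apply_of_mem _ (Set.notMem_compl_iff.1 hv)]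
    rfl
  simpa using Subgroup.mul_mem_sup hcut_mem hrest_mem

theorem mem_rigidStabilizer_sup_farSide {g : Aut} (hg : Labelled g.toPerm) {s : Gen} {u : Grp}
    (hfix : ∀ x ∈ parabolic (labelLink s), g.toPerm (u * x) = u * x)
    (hsgn : sgn g.toPerm s u = 1) :
    g ∈ rigidStabilizer (farSide s u 1) ⊔ rigidStabilizer (farSide s u 1)ᶜ := by
  have himage : g.toPerm '' farSide s u 1 = farSide s u 1 := by
    rw [hg.image_farSide, hsgn, one_mul]
    simpa using congrArg (farSide s · 1) (hfix 1 (one_mem _))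
  refine mem_rigidStabilizer_sup hg (fun v => ?_) fun v w hvw hv hw => ?_
  · conv_lhs => rw [← himage]
    exact g.toPerm.injective.mem_set_image
  · obtain ⟨t, η, rfl⟩ := isEdge_iff.1 hvw.symm
    obtain ⟨rfl, rfl, hlink⟩ := (isFarSide_farSide s u 1 w t η).1 ⟨hw, hv⟩
    have hstar := parabolic_mono (labelLink_subset_labelStar t) hlink
    have hsgn' := hg.sgn_mul_of_mem_star u hstar
    rw [mul_inv_cancel_left, hsgn] at hsgn'
    have hw' := hfix _ hlink
    rw [mul_inv_cancel_left] at hw'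
    rw [hg.map_mul_gen_zpow, hw', hsgn', one_mul]

/-- The subgroup generated by the labelled automorphisms supported in one side of a hyperplane of
label `a`. It turns out to be `AutPlus`. -/
def sideGroup : Subgroup Aut := ⨆ (u : Grp) (ε : ℤˣ), rigidStabilizer (farSide .a u ε)

theorem rigidStabilizer_le_sideGroup (u : Grp) (ε : ℤˣ) :
    rigidStabilizer (farSide .a u ε) ≤ sideGroup :=
  le_iSup₂_of_le u ε le_rfl

theorem mem_sideGroup_of_sgn {g : Aut} (hg : Labelled g.toPerm) {u : Grp} (hu : g.toPerm u = u)
    (ha : sgn g.toPerm .a u = 1) (hb : sgn g.toPerm .b u = 1) : g ∈ sideGroup := by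
  have hfix : ∀ x ∈ parabolic (labelLink .a), g.toPerm (u * x) = u * x := by
    intro x hx
    induction hx using parabolic_induction with
    | one => simpa using hu
    | step x t η hx ht ih =>
      obtain rfl : t = .b := by cases ht; rfl
      have hstar : x ∈ parabolic (labelStar .b) :=
        parabolic_mono (fun t ht => by cases ht; exact .inl rfl) hx
      rw [← mul_assoc, hg.map_mul_gen_zpow, ih, hg.sgn_mul_of_mem_star u hstar, hb, one_mul]
  refine sup_le (rigidStabilizer_le_sideGroup u 1) ?_ (mem_rigidStabilizer_sup_farSide hg hfix ha)
  rw [compl_farSide]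
  exact rigidStabilizer_le_sideGroup _ _

theorem lineFlip_mem_sideGroup {s : Gen} (hs : .d ∉ labelStar s) (u : Grp) :
    (labelled_lineFlip s u).toAut ∈ sideGroup := by
  have hd : Gen.d ≠ s := fun h => hs (.inl h)
  have hsgn : ∀ t, sgn (lineFlip s u) t (u * gen .d) = 1 := fun t => by
    simp [sgn_lineFlip, flipData, gen_notMem_parabolic hs]
  refine mem_sideGroup_of_sgn (u := u * gen .d) (labelled_lineFlip s u) ?_ (hsgn _) (hsgn _)
  simp [(labelled_lineFlip s u).map_mul_gen, sgn_lineFlip_of_ne hd]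

theorem mem_sideGroup_of_map_eq {g : Aut} (hg : Labelled g.toPerm) {u : Grp}
    (hu : g.toPerm u = u) : g ∈ sideGroup := by
  have hflip : ∀ (s t : Gen) {g : Aut}, Labelled g.toPerm → g.toPerm u = u →
      sgn ((labelled_lineFlip s u).toAut * g).toPerm t u =
        sgn (lineFlip s u) t u * sgn g.toPerm t u := fun s t g hg hu => by
    rw [Aut.toPerm_mul, Labelled.toPerm_toAut, (labelled_lineFlip s u).sgn_mul hg, hu]
  have hmem_of_a : ∀ {g : Aut}, Labelled g.toPerm → g.toPerm u = u → sgn g.toPerm .a u = 1 →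
      g ∈ sideGroup := by
    intro g hg hu ha
    rcases Int.units_eq_one_or (sgn g.toPerm .b u) with hb | hb
    · exact mem_sideGroup_of_sgn hg hu ha hb
    have hb_mem := lineFlip_mem_sideGroup (s := .b) (by rintro (h | h) <;> cases h) u
    refine (Subgroup.mul_mem_cancel_left _ hb_mem).1
      (mem_sideGroup_of_sgn (u := u) ((labelled_lineFlip _ _).mul hg) (by simp [hu]) ?_ ?_)
    · rw [hflip _ _ hg hu, ha, sgn_lineFlip_of_ne (by simp), one_mul]
    · rw [hflip _ _ hg hu, hb, sgn_lineFlip_self]; rfl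
  rcases Int.units_eq_one_or (sgn g.toPerm .a u) with ha | ha
  · exact hmem_of_a hg hu ha
  have ha_mem := lineFlip_mem_sideGroup (s := .a) (by rintro (h | h) <;> cases h) u
  refine (Subgroup.mul_mem_cancel_left _ ha_mem).1
    (hmem_of_a ((labelled_lineFlip _ _).mul hg) (by simp [hu]) ?_)
  rw [hflip _ _ hg hu, ha, sgn_lineFlip_self]; rfl

section LabelRigidity

theorem linked_ext {s t : Gen} (h : ∀ r, Linked s r ↔ Linked t r) : s = t := by
  cases s
  case a =>
    cases (h .b).1 .ab with
    | ab => rfl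
    | cb => cases (h .d).2 .cd
  case b => cases (h .a).1 .ba; rfl
  case c => cases (h .d).1 .cd; rfl
  case d =>
    cases (h .c).1 .dc with
    | dc => rfl
    | bc => cases (h .a).2 .ba

theorem eq_or_eq_of_induced_path {w x y z : Gen} (hwx : Linked w x) (hxy : Linked x y)
    (hyz : Linked y z) (hwz : ¬ Linked w z) :
    (w = .a ∧ x = .b ∧ y = .c ∧ z = .d) ∨ (w = .d ∧ x = .c ∧ y = .b ∧ z = .a) := by
  cases hwx <;> cases hxy <;> cases hyz <;> first | exact absurd (by constructor) hwz | simp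

theorem apply_eq_self_of_linked_iff {φ : Gen → Gen}
    (hφ : ∀ s t, Linked (φ s) (φ t) ↔ Linked s t) {s₀ : Gen} (h₀ : φ s₀ = s₀) (s : Gen) :
    φ s = s := by
  rcases eq_or_eq_of_induced_path ((hφ _ _).2 .ab) ((hφ _ _).2 .bc) ((hφ _ _).2 .cd)
    (fun h => by cases (hφ _ _).1 h) with ⟨ha, hb, hc, hd⟩ | ⟨ha, hb, hc, hd⟩
  · cases s <;> assumption
  · cases s₀ <;> simp_all

theorem apply_eq_fst_of_linked_iff {f : Gen × ℤˣ → Gen}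
    (hf : ∀ p q, Linked (f p) (f q) ↔ Linked p.1 q.1) {p₀ : Gen × ℤˣ} (h₀ : f p₀ = p₀.1)
    (p : Gen × ℤˣ) : f p = p.1 := by
  have hfix : ∀ s, f (s, p₀.2) = s :=
    apply_eq_self_of_linked_iff (φ := fun s => f (s, p₀.2)) (fun s t => hf _ _) h₀
  exact linked_ext fun r => by simpa [hfix] using hf p (r, p₀.2)

theorem Aut.exists_map_letter (g : Aut) (v : Grp) (p : Gen × ℤˣ) :
    ∃ q : Gen × ℤˣ, g.toPerm (v * gen p.1 ^ (p.2 : ℤ)) = g.toPerm v * gen q.1 ^ (q.2 : ℤ) := by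
  obtain ⟨t, θ, h⟩ := isEdge_iff.1 ((g.2.1 _ _).2 (isEdge_mul_gen_zpow v p.1 p.2))
  exact ⟨(t, θ), h⟩

theorem exists_isSquareCell_iff_linked (v : Grp) (p q : Gen × ℤˣ) :
    (∃ z, IsSquareCell v (v * gen p.1 ^ (p.2 : ℤ)) z (v * gen q.1 ^ (q.2 : ℤ))) ↔
      Linked p.1 q.1 := by
  refine ⟨fun ⟨z, hz⟩ => ?_, fun h => ⟨_, isSquareCell_of_linked h v p.2 q.2⟩⟩
  obtain ⟨s, t, η, θ, hst, hp, -, hq⟩ := isSquareCell_iff.1 hz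
  rw [mul_right_inj, gen_zpow_units_inj] at hp hq
  rwa [hp.1, hq.1]

theorem Aut.exists_isSquareCell_map_iff (g : Aut) (v w u : Grp) :
    (∃ z, IsSquareCell (g.toPerm v) (g.toPerm w) z (g.toPerm u)) ↔ ∃ z, IsSquareCell v w z u := by
  rw [g.toPerm.surjective.exists]
  exact exists_congr fun z => g.2.2 v w z u

theorem Aut.preserves_labels (g : Aut) {v : Grp} {s : Gen} {η θ : ℤˣ}
    (h : g.toPerm (v * gen s ^ (η : ℤ)) = g.toPerm v * gen s ^ (θ : ℤ)) (t : Gen) (ζ : ℤˣ) :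
    ∃ ξ : ℤˣ, g.toPerm (v * gen t ^ (ζ : ℤ)) = g.toPerm v * gen t ^ (ξ : ℤ) := by
  choose f hf using g.exists_map_letter v
  have hlinked : ∀ p q : Gen × ℤˣ, Linked (f p).1 (f q).1 ↔ Linked p.1 q.1 := fun p q => by
    rw [← exists_isSquareCell_iff_linked (g.toPerm v), ← exists_isSquareCell_iff_linked v, ← hf,
      ← hf, g.exists_isSquareCell_map_iff]
  have h₀ : (f (s, η)).1 = s := by
    have hs := hf (s, η)
    rw [h, mul_right_inj, gen_zpow_units_inj] at hs
    exact hs.1.symm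
  have ht : (f (t, ζ)).1 = t :=
    apply_eq_fst_of_linked_iff (f := fun p => (f p).1) hlinked (p₀ := (s, η)) h₀ (t, ζ)
  exact ⟨(f (t, ζ)).2, by simpa only [ht] using hf (t, ζ)⟩

theorem Aut.labelled_of_edge (g : Aut) {v : Grp} {s : Gen} {η θ : ℤˣ}
    (h : g.toPerm (v * gen s ^ (η : ℤ)) = g.toPerm v * gen s ^ (θ : ℤ)) : Labelled g.toPerm := by
  have hedge : ∀ w, ∃ (s : Gen) (η θ : ℤˣ),
      g.toPerm (w * gen s ^ (η : ℤ)) = g.toPerm w * gen s ^ (θ : ℤ) := by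
    intro w
    induction w using vertex_induction v with
    | base => exact ⟨s, η, θ, h⟩
    | step w t ζ ih =>
      obtain ⟨s, η, θ, h⟩ := ih
      obtain ⟨ξ, hξ⟩ := g.preserves_labels h t ζ
      exact ⟨t, -ζ, -ξ, by simp [hξ]⟩
  intro w t
  obtain ⟨s, η, θ, h⟩ := hedge w
  obtain ⟨ξ, hξ⟩ := g.preserves_labels h t 1
  exact ⟨ξ, by simpa using hξ⟩

end LabelRigidity

section Square

variable {v w z u : Grp} {p q : ℝ}

theorem IsSquareCell.isEdge (h : IsSquareCell v w z u) : IsEdge v w := by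
  obtain ⟨s, t, x, y, -, hx, -, hw, -⟩ := h
  exact ⟨s, x, hx, hw⟩

theorem IsSquareCell.swap (h : IsSquareCell v w z u) : IsSquareCell v u z w := by
  obtain ⟨s, t, η, θ, hst, rfl, rfl, rfl⟩ := isSquareCell_iff.1 h
  rw [mul_assoc, ((commute_gen hst).zpow_zpow _ _).eq, ← mul_assoc]
  exact isSquareCell_of_linked hst.symm v θ η

theorem IsSquareCell.reverse (h : IsSquareCell v w z u) : IsSquareCell w v u z := by
  obtain ⟨s, t, η, θ, hst, rfl, rfl, rfl⟩ := isSquareCell_iff.1 h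
  simpa using isSquareCell_of_linked hst (v * gen s ^ (η : ℤ)) (-η) θ

theorem IsEdge.ne (h : IsEdge v w) : v ≠ w := by
  obtain ⟨s, η, rfl⟩ := isEdge_iff.1 h
  have hne : gen s ^ (η : ℤ) ≠ gen s ^ (0 : ℤ) := gen_zpow_inj.not.2 η.ne_zero
  simpa using hne

theorem IsSquareCell.ne_opposite (h : IsSquareCell v w z u) : v ≠ z := by
  obtain ⟨s, t, η, θ, hst, rfl, rfl, rfl⟩ := isSquareCell_iff.1 h
  intro heq
  rw [mul_assoc, left_eq_mul] at heq
  have hexpo := congrArg (expo s) heq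
  rw [map_mul, expo_gen_zpow_self, expo_gen_zpow_of_ne hst.ne, mul_one, map_one, ← ofAdd_zero]
    at hexpo
  exact η.ne_zero (Multiplicative.ofAdd.injective hexpo)

theorem squarePoint_swap : squarePoint v u z w q p = squarePoint v w z u p q := by
  simp only [squarePoint]
  module

theorem squarePoint_reverse : squarePoint w v u z (1 - p) q = squarePoint v w z u p q := by
  simp only [squarePoint]
  module

theorem squarePoint_zero_right : squarePoint v w z u p 0 = (1 - p) • dirac v + p • dirac w := by
  simp [squarePoint]

theorem dirac_self (v : Grp) : dirac v v = 1 := by simp [dirac]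

theorem dirac_of_ne (h : v ≠ w) : dirac v w = 0 := by simp [dirac, h.symm]

theorem dirac_injective : Function.Injective dirac := by
  intro v w h
  by_contra hne
  have hv := congrFun h v
  rw [dirac_self, dirac_of_ne (Ne.symm hne)] at hv
  exact one_ne_zero hv

theorem squarePoint_apply_first (h : IsSquareCell v w z u) :
    squarePoint v w z u p q v = (1 - p) * (1 - q) := by
  simp [squarePoint, dirac_self, dirac_of_ne h.isEdge.ne.symm, dirac_of_ne h.ne_opposite.symm,
    dirac_of_ne h.swap.isEdge.ne.symm]

theorem squarePoint_apply_second (h : IsSquareCell v w z u) :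
    squarePoint v w z u p q w = p * (1 - q) := by
  rw [← squarePoint_reverse, squarePoint_apply_first h.reverse, sub_sub_cancel]

theorem squarePoint_apply_fourth (h : IsSquareCell v w z u) :
    squarePoint v w z u p q u = (1 - p) * q := by
  rw [← squarePoint_swap, squarePoint_apply_second h.swap, mul_comm]

theorem squarePoint_apply_third (h : IsSquareCell v w z u) :
    squarePoint v w z u p q z = p * q := by
  rw [← squarePoint_reverse, squarePoint_apply_fourth h.reverse, sub_sub_cancel]

theorem squarePoint_apply_of_ne {y : Grp} (hv : v ≠ y) (hw : w ≠ y) (hz : z ≠ y) (hu : u ≠ y) :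
    squarePoint v w z u p q y = 0 := by
  simp [squarePoint, dirac_of_ne hv, dirac_of_ne hw, dirac_of_ne hz, dirac_of_ne hu]

theorem squarePoint_mem_realization (h : IsSquareCell v w z u) (hp : p ∈ Set.Icc (0 : ℝ) 1)
    (hq : q ∈ Set.Icc (0 : ℝ) 1) : squarePoint v w z u p q ∈ realization :=
  ⟨v, w, z, u, h, p, hp, q, hq, rfl⟩

theorem act_eq_iff (g : Aut) (x : X) (hx : x.1 = squarePoint v w z u p q) : act g x = x ↔
    squarePoint (g.toPerm v) (g.toPerm w) (g.toPerm z) (g.toPerm u) p q =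
      squarePoint v w z u p q := by
  rw [← squarePoint_comp, Subtype.ext_iff]
  change (fun y => x.1 (g.toPerm.symm y)) = x.1 ↔ _
  rw [hx]

end Square

section Quarter

variable {v w z u : Grp} {p q : ℝ}

theorem squarePoint_lt_first (h : IsSquareCell v w z u) (hp : p ∈ Set.Ico (0 : ℝ) (1 / 2))
    (hq : q ∈ Set.Ico (0 : ℝ) (1 / 2)) {y : Grp} (hy : y ≠ v) :
    squarePoint v w z u p q y < squarePoint v w z u p q v := by
  obtain ⟨hp0, hp1⟩ := hp
  obtain ⟨hq0, hq1⟩ := hq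
  rw [squarePoint_apply_first h]
  by_cases hw : y = w
  · rw [hw, squarePoint_apply_second h]
    nlinarith
  by_cases hz : y = z
  · rw [hz, squarePoint_apply_third h]
    nlinarith
  by_cases hu : y = u
  · rw [hu, squarePoint_apply_fourth h]
    nlinarith
  rw [squarePoint_apply_of_ne (Ne.symm hy) (Ne.symm hw) (Ne.symm hz) (Ne.symm hu)]
  nlinarith

theorem exists_ne_apply_eq_of_mem_hyperplane {v₀ w₀ y : Grp} {x : X} (hx : x ∈ hyperplane v₀ w₀)
    (hy : x.1 y ≠ 0) : ∃ y' ≠ y, x.1 y' = x.1 y := by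
  obtain ⟨v, w, z, u, -, h, q, -, hxq⟩ := hx
  rw [hxq] at hy ⊢
  have hvw : squarePoint v w z u (1 / 2) q v = squarePoint v w z u (1 / 2) q w := by
    rw [squarePoint_apply_first h, squarePoint_apply_second h]
    ring
  have huz : squarePoint v w z u (1 / 2) q u = squarePoint v w z u (1 / 2) q z := by
    rw [squarePoint_apply_fourth h, squarePoint_apply_third h]
    ring
  have hne : u ≠ z := h.swap.reverse.swap.isEdge.ne
  by_cases hv : v = y
  · exact ⟨w, hv ▸ h.isEdge.ne.symm, hv ▸ hvw.symm⟩
  by_cases hw : w = y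
  · exact ⟨v, hv, hw ▸ hvw⟩
  by_cases hz : z = y
  · exact ⟨u, hz ▸ hne, hz ▸ huz⟩
  by_cases hu : u = y
  · exact ⟨z, hz, hu ▸ huz.symm⟩
  exact absurd (squarePoint_apply_of_ne hv hw hz hu) hy

theorem notMem_hyperplane_of_quarter (h : IsSquareCell v w z u)
    (hp : p ∈ Set.Ico (0 : ℝ) (1 / 2)) (hq : q ∈ Set.Ico (0 : ℝ) (1 / 2)) {x : X}
    (hx : x.1 = squarePoint v w z u p q) (v₀ w₀ : Grp) : x ∉ hyperplane v₀ w₀ := by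
  intro hmem
  have hpos : x.1 v ≠ 0 := by
    rw [hx, squarePoint_apply_first h]
    exact mul_ne_zero (by linarith [hp.2]) (by linarith [hq.2])
  obtain ⟨y, hy, heq⟩ := exists_ne_apply_eq_of_mem_hyperplane hmem hpos
  rw [hx] at heq
  exact (squarePoint_lt_first h hp hq hy).ne heq

theorem exists_eq_squarePoint_quarter (x : X) : ∃ v w z u, IsSquareCell v w z u ∧
    ∃ p ∈ Set.Icc (0 : ℝ) (1 / 2), ∃ q ∈ Set.Icc (0 : ℝ) (1 / 2),
      x.1 = squarePoint v w z u p q := by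
  have hhalf : ∃ v w z u, IsSquareCell v w z u ∧
      ∃ p ∈ Set.Icc (0 : ℝ) (1 / 2), ∃ q ∈ Set.Icc (0 : ℝ) 1, x.1 = squarePoint v w z u p q := by
    obtain ⟨v, w, z, u, h, p, hp, q, hq, hx⟩ := x.2
    rcases le_total p (1 / 2) with hle | hle
    · exact ⟨v, w, z, u, h, p, ⟨hp.1, hle⟩, q, hq, hx⟩
    · exact ⟨w, v, u, z, h.reverse, 1 - p, ⟨by linarith [hp.2], by linarith⟩, q, hq, by
        rw [hx, squarePoint_reverse]⟩
  obtain ⟨v, w, z, u, h, p, hp, q, hq, hx⟩ := hhalf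
  rcases le_total q (1 / 2) with hle | hle
  · exact ⟨v, w, z, u, h, p, hp, q, ⟨hq.1, hle⟩, hx⟩
  · exact ⟨u, v, w, z, h.swap.reverse, 1 - q, ⟨by linarith [hq.2], by linarith⟩, p, hp, by
      rw [hx, squarePoint_reverse, squarePoint_swap]⟩

/-- The coordinates of the points in the open quarter of a square at its first corner, together with
`(p, q)`. -/
def pointedQuarter (p q : ℝ) : Set (ℝ × ℝ) :=
  insert (p, q) (Set.Ico 0 (1 / 2) ×ˢ Set.Ico 0 (1 / 2))

theorem isPreconnected_pointedQuarter (hp : p ∈ Set.Icc (0 : ℝ) (1 / 2))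
    (hq : q ∈ Set.Icc (0 : ℝ) (1 / 2)) : IsPreconnected (pointedQuarter p q) := by
  refine (isPreconnected_Ico.prod isPreconnected_Ico).subset_closure (Set.subset_insert _ _)
    (Set.insert_subset ?_ subset_closure)
  rw [closure_prod_eq, closure_Ico (by norm_num)]
  exact ⟨hp, hq⟩

theorem isPreconnected_setOf_squarePoint (h : IsSquareCell v w z u) {D : Set (ℝ × ℝ)}
    (hD : IsPreconnected D) (hsub : D ⊆ Set.Icc 0 1 ×ˢ Set.Icc 0 1) :
    IsPreconnected {x : X | ∃ r ∈ D, x.1 = squarePoint v w z u r.1 r.2} := by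
  rw [← IsInducing.subtypeVal.isPreconnected_image]
  convert hD.image (fun r => squarePoint v w z u r.1 r.2) ?_
  · ext x
    constructor
    · rintro ⟨y, ⟨r, hr, hy⟩, rfl⟩
      exact ⟨r, hr, hy.symm⟩
    · rintro ⟨r, hr, rfl⟩
      exact ⟨⟨_, squarePoint_mem_realization h (hsub hr).1 (hsub hr).2⟩, ⟨r, hr, rfl⟩, rfl⟩
  · refine Continuous.continuousOn (continuous_pi fun y => ?_)
    simp only [squarePoint, Pi.add_apply, Pi.smul_apply, smul_eq_mul]
    fun_prop

theorem IsHalfspace.exists_quarter {h : Set X} (hh : IsHalfspace h) :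
    ∃ v w z u, IsSquareCell v w z u ∧ ∀ p ∈ Set.Ico (0 : ℝ) (1 / 2), ∀ q ∈ Set.Ico (0 : ℝ) (1 / 2),
      ∃ x ∈ h, x.1 = squarePoint v w z u p q := by
  obtain ⟨v₀, w₀, -, x, hx, rfl⟩ := hh
  obtain ⟨v, w, z, u, hc, p, hp, q, hq, hxpq⟩ := exists_eq_squarePoint_quarter x
  have hsub : pointedQuarter p q ⊆ Set.Icc 0 1 ×ˢ Set.Icc 0 1 := by
    have hle : Set.Icc (0 : ℝ) (1 / 2) ⊆ Set.Icc 0 1 := Set.Icc_subset_Icc_right (by norm_num)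
    exact Set.insert_subset ⟨hle hp, hle hq⟩ (Set.prod_mono (Set.Ico_subset_Icc_self.trans hle)
      (Set.Ico_subset_Icc_self.trans hle))
  have hcomponent := (isPreconnected_setOf_squarePoint hc (isPreconnected_pointedQuarter hp hq)
    hsub).subset_connectedComponentIn (F := (hyperplane v₀ w₀)ᶜ)
    ⟨(p, q), Set.mem_insert _ _, hxpq⟩ (by
      rintro y ⟨r, rfl | hr, hy⟩
      · rwa [Subtype.ext (hy.trans hxpq.symm)]
      · exact notMem_hyperplane_of_quarter hc hr.1 hr.2 hy v₀ w₀)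
  refine ⟨v, w, z, u, hc, fun p' hp' q' hq' => ?_⟩
  have hmem : (p', q') ∈ pointedQuarter p q := .inr ⟨hp', hq'⟩
  exact ⟨⟨_, squarePoint_mem_realization hc (hsub hmem).1 (hsub hmem).2⟩,
    hcomponent ⟨_, hmem, rfl⟩, rfl⟩

theorem labelled_of_fixes_halfspace {g : Aut} {h : Set X} (hh : IsHalfspace h)
    (hg : ∀ x ∈ h, act g x = x) : Labelled g.toPerm ∧ ∃ v, g.toPerm v = v := by
  obtain ⟨v, w, z, u, hc, hquarter⟩ := hh.exists_quarter
  have hfix : ∀ p ∈ Set.Ico (0 : ℝ) (1 / 2),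
      (1 - p) • dirac (g.toPerm v) + p • dirac (g.toPerm w) =
        (1 - p) • dirac v + p • dirac w := fun p hp => by
    obtain ⟨x, hx, hxp⟩ := hquarter p hp 0 (by norm_num)
    simpa only [squarePoint_zero_right] using (act_eq_iff g x hxp).1 (hg x hx)
  have hv : g.toPerm v = v := dirac_injective (by simpa using hfix 0 (by norm_num))
  have hw : g.toPerm w = w := by
    have hquart := hfix (1 / 4) (by norm_num)
    rw [hv, add_right_inj] at hquart
    exact dirac_injective (smul_right_injective _ (by norm_num) hquart)
  obtain ⟨s, η, rfl⟩ := isEdge_iff.1 hc.isEdge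
  exact ⟨g.labelled_of_edge (η := η) (θ := η) (by rw [hw, hv]), v, hv⟩

end Quarter

theorem autPlus_le_sideGroup : AutPlus ≤ sideGroup := by
  refine (Subgroup.closure_le _).2 ?_
  rintro g ⟨h, hh, hg⟩
  obtain ⟨hlabelled, v, hv⟩ := labelled_of_fixes_halfspace hh hg
  exact mem_sideGroup_of_map_eq hlabelled hv

section Heavy

variable {v w z u : Grp} {p q : ℝ}

/-- The points with more than half of their mass on the vertices in `S`. -/
def heavy (S : Set Grp) : Set X := {x | ∃ F : Finset Grp, ↑F ⊆ S ∧ 1 / 2 < ∑ y ∈ F, x.1 y}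

theorem isOpen_heavy (S : Set Grp) : IsOpen (heavy S) := by
  have hunion : heavy S = ⋃ (F : Finset Grp) (_ : ↑F ⊆ S), {x : X | 1 / 2 < ∑ y ∈ F, x.1 y} := by
    ext x; simp [heavy]
  rw [hunion]
  refine isOpen_iUnion fun F => isOpen_iUnion fun _ => isOpen_lt continuous_const ?_
  exact continuous_finsetSum _ fun y _ => (continuous_apply y).comp continuous_subtype_val

theorem sum_squarePoint (F : Finset Grp) : ∑ y ∈ F, squarePoint v w z u p q y =
    (1 - p) * (1 - q) * Set.indicator F 1 v + p * (1 - q) * Set.indicator F 1 w +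
      p * q * Set.indicator F 1 z + (1 - p) * q * Set.indicator F 1 u := by
  classical
  have hdirac : ∀ v : Grp, ∑ y ∈ F, dirac v y = Set.indicator F 1 v := fun v => by
    simp [dirac, Set.indicator_apply]
  simp only [squarePoint, Pi.add_apply, Pi.smul_apply, smul_eq_mul, Finset.sum_add_distrib,
    ← Finset.mul_sum, hdirac]

theorem mem_heavy_iff {S : Set Grp} (hp : p ∈ Set.Icc (0 : ℝ) 1) (hq : q ∈ Set.Icc (0 : ℝ) 1)
    {x : X} (hx : x.1 = squarePoint v w z u p q) : x ∈ heavy S ↔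
      1 / 2 < (1 - p) * (1 - q) * S.indicator 1 v + p * (1 - q) * S.indicator 1 w +
        p * q * S.indicator 1 z + (1 - p) * q * S.indicator 1 u := by
  classical
  constructor
  · rintro ⟨F, hF, hlt⟩
    rw [hx, sum_squarePoint] at hlt
    refine hlt.trans_le ?_
    have hp₀ := hp.1
    have hq₀ := hq.1
    have hp₁ := sub_nonneg.2 hp.2
    have hq₁ := sub_nonneg.2 hq.2
    gcongr <;> simp
  · intro hlt
    refine ⟨Finset.filter (· ∈ S) {v, w, z, u}, fun y hy => (Finset.mem_filter.1 hy).2, ?_⟩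
    rw [hx, sum_squarePoint]
    simpa [Set.indicator_apply] using hlt

theorem disjoint_heavy_compl (S : Set Grp) : Disjoint (heavy S) (heavy Sᶜ) := by
  refine Set.disjoint_left.2 fun x hS hcompl => ?_
  obtain ⟨v, w, z, u, -, p, hp, q, hq, hx⟩ := x.2
  rw [mem_heavy_iff hp hq hx] at hS hcompl
  simp only [Set.indicator_compl, Pi.sub_apply, Pi.one_apply] at hcompl
  linarith

theorem exists_corner_mem_of_mem_heavy {S : Set Grp} (hp : p ∈ Set.Icc (0 : ℝ) 1)
    (hq : q ∈ Set.Icc (0 : ℝ) 1) {x : X} (hx : x.1 = squarePoint v w z u p q) (h : x ∈ heavy S) :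
    v ∈ S ∨ w ∈ S ∨ z ∈ S ∨ u ∈ S := by
  rw [mem_heavy_iff hp hq hx] at h
  by_contra! hnot
  norm_num [hnot.1, hnot.2.1, hnot.2.2.1, hnot.2.2.2] at h

end Heavy

section FixedHalfspace

variable {S : Set Grp} {s : Gen} {u₀ : Grp} {ε : ℤˣ}

theorem parallel_of_mem_link (u : Grp) (ε : ℤˣ) {x : Grp} (hx : x ∈ parabolic (labelLink s)) :
    Parallel (u, u * gen s ^ (ε : ℤ)) (u * x, u * x * gen s ^ (ε : ℤ)) := by
  induction hx using parabolic_induction with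
  | one => simpa using! Relation.EqvGen.refl _
  | step x t η _ ht ih =>
    refine ih.trans _ _ _ (.rel _ _ ?_)
    have hcomm := ((commute_gen ht).zpow_zpow (ε : ℤ) (η : ℤ)).eq
    simpa only [mul_assoc, hcomm] using isSquareCell_of_linked ht (u * x) ε η

theorem IsFarSide.of_isEdge (h : IsFarSide S s u₀ ε) {v w : Grp} (hvw : IsEdge v w) (hv : v ∉ S)
    (hw : w ∈ S) : w = v * gen s ^ (ε : ℤ) ∧ u₀⁻¹ * v ∈ parabolic (labelLink s) := by
  obtain ⟨t, η, rfl⟩ := isEdge_iff.1 hvw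
  obtain ⟨rfl, rfl, hlink⟩ := (h v t η).1 ⟨hv, hw⟩
  exact ⟨rfl, hlink⟩

theorem IsFarSide.exists_eq_squarePoint (h : IsFarSide S s u₀ ε) (x : X) :
    ∃ v w z u, IsSquareCell v w z u ∧ (v ∈ S → w ∈ S) ∧ (u ∈ S ↔ v ∈ S) ∧ (z ∈ S ↔ w ∈ S) ∧
      ∃ p ∈ Set.Icc (0 : ℝ) 1, ∃ q ∈ Set.Icc (0 : ℝ) 1, x.1 = squarePoint v w z u p q := by
  have hparallel : ∃ v w z u, IsSquareCell v w z u ∧ (u ∈ S ↔ v ∈ S) ∧ (z ∈ S ↔ w ∈ S) ∧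
      ∃ p ∈ Set.Icc (0 : ℝ) 1, ∃ q ∈ Set.Icc (0 : ℝ) 1, x.1 = squarePoint v w z u p q := by
    obtain ⟨v, w, z, u, hc, p, hp, q, hq, hx⟩ := x.2
    obtain ⟨t, r, η, θ, htr, hw, hz, hu⟩ := isSquareCell_iff.1 hc
    by_cases hr : r = s
    · have ht : t ≠ s := hr ▸ htr.ne
      refine ⟨v, u, z, w, hc.swap, ?_, ?_, q, hq, p, hp, hx.trans squarePoint_swap.symm⟩
      · rw [hw, h.mem_iff_of_ne v ht]
      · rw [hz, mul_assoc, ((commute_gen htr).zpow_zpow _ _).eq, ← mul_assoc, hu,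
          h.mem_iff_of_ne _ ht]
    · refine ⟨v, w, z, u, hc, ?_, ?_, p, hp, q, hq, hx⟩
      · rw [hu, h.mem_iff_of_ne v hr]
      · rw [hz, hw, h.mem_iff_of_ne _ hr]
  obtain ⟨v, w, z, u, hc, huv, hzw, p, hp, q, hq, hx⟩ := hparallel
  by_cases hvw : v ∈ S → w ∈ S
  · exact ⟨v, w, z, u, hc, hvw, huv, hzw, p, hp, q, hq, hx⟩
  · exact ⟨w, v, u, z, hc.reverse, by tauto, hzw, huv, 1 - p,
      ⟨by linarith [hp.2], by linarith [hp.1]⟩, q, hq, hx.trans squarePoint_reverse.symm⟩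

theorem IsFarSide.mem_heavy_or_mem_heavy_compl (h : IsFarSide S s u₀ ε) {x : X}
    (hx : x ∉ hyperplane u₀ (u₀ * gen s ^ (ε : ℤ))) : x ∈ heavy S ∨ x ∈ heavy Sᶜ := by
  obtain ⟨v, w, z, u, hc, hvw, huv, hzw, p, hp, q, hq, hxpq⟩ := h.exists_eq_squarePoint x
  classical
  simp only [mem_heavy_iff hp hq hxpq, Set.indicator_apply, Set.mem_compl_iff, huv, hzw,
    Pi.one_apply]
  by_cases hv : v ∈ S
  · left
    simp only [hv, hvw hv, if_true]
    linarith
  by_cases hw : w ∈ S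
  · obtain ⟨rfl, hlink⟩ := h.of_isEdge hc.isEdge hv hw
    have hne : p ≠ 1 / 2 := by
      rintro rfl
      refine hx ⟨v, _, z, u, ?_, hc, q, hq, hxpq⟩
      simpa using parallel_of_mem_link u₀ ε hlink
    simp only [hv, hw, if_true, if_false, not_true, not_false_iff]
    rcases hne.lt_or_gt with hlt | hgt
    · right; linarith
    · left; linarith
  · right
    simp only [hv, hw, if_true, not_false_iff]
    linarith

theorem IsFarSide.map_eq_of_isSquareCell (h : IsFarSide S s u₀ ε) {σ : Equiv.Perm Grp}
    (hσ : Labelled σ) (hfix : ∀ v ∉ S, σ v = v) {v w z u : Grp} (hc : IsSquareCell v w z u)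
    (hv : v ∉ S) : σ v = v ∧ σ w = w ∧ σ z = z ∧ σ u = u := by
  refine ⟨hfix v hv, h.map_eq_of_isEdge hσ hfix hv hc.isEdge, ?_,
    h.map_eq_of_isEdge hσ hfix hv hc.swap.isEdge⟩
  by_cases hw : w ∈ S
  · by_cases hu : u ∈ S
    · have hwu : w = u := (h.of_isEdge hc.isEdge hv hw).1.trans
        (h.of_isEdge hc.swap.isEdge hv hu).1.symm
      exact absurd hwu hc.reverse.ne_opposite
    · exact h.map_eq_of_isEdge hσ hfix hu hc.swap.reverse.swap.isEdge
  · exact h.map_eq_of_isEdge hσ hfix hw hc.reverse.swap.isEdge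

theorem IsFarSide.act_eq_of_mem_heavy_compl (h : IsFarSide S s u₀ ε) {g : Aut}
    (hg : g ∈ rigidStabilizer S) {x : X} (hx : x ∈ heavy Sᶜ) : act g x = x := by
  obtain ⟨v, w, z, u, hc, p, hp, q, hq, hxpq⟩ := x.2
  rw [act_eq_iff g x hxpq]
  suffices hfix : g.toPerm v = v ∧ g.toPerm w = w ∧ g.toPerm z = z ∧ g.toPerm u = u by
    rw [hfix.1, hfix.2.1, hfix.2.2.1, hfix.2.2.2]
  rcases exists_corner_mem_of_mem_heavy hp hq hxpq hx with hv | hw | hz | hu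
  · exact h.map_eq_of_isSquareCell hg.1 hg.2 hc hv
  · have := h.map_eq_of_isSquareCell hg.1 hg.2 hc.reverse hw
    tauto
  · have := h.map_eq_of_isSquareCell hg.1 hg.2 hc.reverse.swap.reverse hz
    tauto
  · have := h.map_eq_of_isSquareCell hg.1 hg.2 hc.swap.reverse hu
    tauto

theorem exists_linked (s : Gen) : ∃ t, Linked s t := by
  cases s
  exacts [⟨_, .ab⟩, ⟨_, .ba⟩, ⟨_, .cb⟩, ⟨_, .dc⟩]

theorem IsFarSide.exists_isHalfspace (h : IsFarSide S s u₀ ε) :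
    ∃ C : Set X, IsHalfspace C ∧ C ⊆ heavy Sᶜ := by
  obtain ⟨t, ht⟩ := exists_linked s
  have hc := isSquareCell_of_linked ht u₀ ε 1
  let x₀ : X := ⟨_, squarePoint_mem_realization hc (p := 0) (q := 0) (by norm_num) (by norm_num)⟩
  have hx₀ : x₀ ∈ (hyperplane u₀ (u₀ * gen s ^ (ε : ℤ)))ᶜ :=
    notMem_hyperplane_of_quarter hc (by norm_num) (by norm_num) rfl _ _
  have hheavy : x₀ ∈ heavy Sᶜ := by
    rw [mem_heavy_iff (p := 0) (q := 0) (by norm_num) (by norm_num) rfl]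
    norm_num [h.notMem]
  refine ⟨_, ⟨_, _, isEdge_mul_gen_zpow u₀ s ε, x₀, hx₀, rfl⟩, ?_⟩
  exact isPreconnected_connectedComponentIn.subset_right_of_subset_union (isOpen_heavy _)
    (isOpen_heavy _) (disjoint_heavy_compl S)
    (fun x hx => h.mem_heavy_or_mem_heavy_compl (connectedComponentIn_subset _ _ hx))
    ⟨x₀, mem_connectedComponentIn hx₀, hheavy⟩

theorem IsFarSide.rigidStabilizer_le_autPlus (h : IsFarSide S s u₀ ε) :
    rigidStabilizer S ≤ AutPlus := fun _ hg =>
  have ⟨C, hC, hsub⟩ := h.exists_isHalfspace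
  Subgroup.subset_closure ⟨C, hC, fun _ hx => h.act_eq_of_mem_heavy_compl hg (hsub hx)⟩

end FixedHalfspace

theorem autPlus_eq_sideGroup : AutPlus = sideGroup :=
  autPlus_le_sideGroup.antisymm
    (iSup₂_le fun u ε => (isFarSide_farSide .a u ε).rigidStabilizer_le_autPlus)

theorem mem_autPlus_of_map_eq {g : Aut} (hg : Labelled g.toPerm) {u : Grp}
    (hu : g.toPerm u = u) : g ∈ AutPlus :=
  autPlus_eq_sideGroup ▸ mem_sideGroup_of_map_eq hg hu

theorem labelled_of_mem_autPlus {g : Aut} (hg : g ∈ AutPlus) : Labelled g.toPerm := by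
  induction hg using Subgroup.closure_induction with
  | mem g hg => obtain ⟨h, hh, hfix⟩ := hg; exact (labelled_of_fixes_halfspace hh hfix).1
  | one => exact .one
  | mul g g' _ _ hg hg' => exact hg.mul hg'
  | inv g _ hg => exact hg.inv

section Topology

instance : TopologicalSpace Grp := ⊥

instance : DiscreteTopology Grp := ⟨rfl⟩

theorem continuous_of_continuous_toPerm {Y : Type*} [TopologicalSpace Y] {f : Y → Aut}
    (hf : ∀ v, Continuous fun y => (f y).toPerm v) : Continuous f := by
  refine continuous_induced_rng.2 (ContinuousMap.continuous_of_continuous_uncurry _ ?_)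
  refine Continuous.subtype_mk (continuous_pi fun w => ?_) _
  change Continuous fun r : Y × X => r.2.1 ((f r.1).toPerm.symm w)
  refine continuous_iff_continuousAt.2 fun ⟨y, x⟩ => ?_
  -- Near `y` the vertex `(f y)⁻¹ w` does not depend on `y`.
  have hlocal : ∀ᶠ r : Y × X in 𝓝 (y, x), (f r.1).toPerm ((f y).toPerm.symm w) = w :=
    ((isOpen_discrete {w}).preimage ((hf _).comp continuous_fst)).mem_nhds (by simp)
  have hcoord : Continuous fun r : Y × X => r.2.1 ((f y).toPerm.symm w) :=
    (continuous_apply _).comp (continuous_subtype_val.comp continuous_snd)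
  refine hcoord.continuousAt.congr (hlocal.mono fun r hr => ?_)
  exact congrArg r.2.1 ((Equiv.eq_symm_apply _).2 hr)

theorem dirac_mem_realization (v : Grp) : dirac v ∈ realization := by
  have h := squarePoint_mem_realization (isSquareCell_of_linked .ab v 1 1) (p := 0) (q := 0)
    (by norm_num) (by norm_num)
  simpa [squarePoint] using h

theorem continuous_toPerm (v : Grp) : Continuous fun g : Aut => g.toPerm v := by
  have hact : Continuous fun g : Aut => act g ⟨dirac v, dirac_mem_realization v⟩ :=
    (ContinuousEvalConst.continuous_eval_const _).comp continuous_induced_dom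
  have hcoord : ∀ w, Continuous fun g : Aut => dirac (g.toPerm v) w := fun w =>
    ((continuous_apply w).comp (continuous_subtype_val.comp hact)).congr fun g =>
      congrFun (dirac_comp g v) w
  refine continuous_discrete_rng.2 fun w => ?_
  have hpreimage :
      (fun g : Aut => g.toPerm v) ⁻¹' {w} = {g | 1 / 2 < dirac (g.toPerm v) w} := by
    ext g
    by_cases h : g.toPerm v = w
    · norm_num [h, dirac_self]
    · norm_num [h, dirac_of_ne h]
  exact hpreimage ▸ isOpen_lt continuous_const (hcoord w)

theorem continuous_iff_toPerm {Y : Type*} [TopologicalSpace Y] {f : Y → Aut} :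
    Continuous f ↔ ∀ v, Continuous fun y => (f y).toPerm v :=
  ⟨fun h v => (continuous_toPerm v).comp h, continuous_of_continuous_toPerm⟩

theorem isOpen_toPerm_eq (v w : Grp) : IsOpen {g : Aut | g.toPerm v = w} :=
  (isOpen_discrete {w}).preimage (continuous_toPerm v)

instance : IsTopologicalGroup Aut where
  continuous_mul := by
    refine continuous_iff_toPerm.2 fun v => continuous_discrete_rng.2 fun w => ?_
    have hpreimage : (fun r : Aut × Aut => (r.1 * r.2).toPerm v) ⁻¹' {w} =
        ⋃ u, {g : Aut | g.toPerm u = w} ×ˢ {g : Aut | g.toPerm v = u} := by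
      ext r; simp [Aut.toPerm_mul]
    rw [hpreimage]
    exact isOpen_iUnion fun u => (isOpen_toPerm_eq u w).prod (isOpen_toPerm_eq v u)
  continuous_inv := by
    refine continuous_iff_toPerm.2 fun v => continuous_discrete_rng.2 fun w => ?_
    have hpreimage : (fun g : Aut => g⁻¹.toPerm v) ⁻¹' {w} = {g : Aut | g.toPerm w = v} := by
      ext g
      rw [Set.mem_preimage, Set.mem_singleton_iff, Aut.toPerm_inv, Equiv.Perm.inv_eq_iff_eq]
      exact eq_comm
    exact hpreimage ▸ isOpen_toPerm_eq w v

theorem injective_coe_toPerm : Function.Injective fun g : Aut => ⇑g.toPerm :=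
  DFunLike.coe_injective.comp Aut.toPerm_injective

instance : TotallyDisconnectedSpace Aut :=
  ⟨isTotallyDisconnected_of_image (continuous_pi continuous_toPerm).continuousOn
    injective_coe_toPerm (isTotallyDisconnected_of_totallyDisconnectedSpace _)⟩

/-- The label preserving automorphisms that fix the vertex `1`. -/
def baseStabilizer : Subgroup Aut where
  carrier := {g | Labelled g.toPerm ∧ g.toPerm 1 = 1}
  one_mem' := ⟨.one, rfl⟩
  mul_mem' {g h} hg hh := ⟨hg.1.mul hh.1, by rw [Aut.toPerm_mul, Equiv.Perm.mul_apply, hh.2, hg.2]⟩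
  inv_mem' {g} hg := ⟨hg.1.inv, by rw [Aut.toPerm_inv, Equiv.Perm.inv_eq_iff_eq, hg.2]⟩

theorem baseStabilizer_le_autPlus : baseStabilizer ≤ AutPlus :=
  fun _ hg => mem_autPlus_of_map_eq hg.1 hg.2

theorem isOpen_baseStabilizer : IsOpen (baseStabilizer : Set Aut) := by
  refine Subgroup.isOpen_of_mem_nhds _ (g := 1) ?_
  have hopen := (isOpen_toPerm_eq 1 1).inter (isOpen_toPerm_eq (gen .a) (gen .a))
  refine Filter.mem_of_superset (hopen.mem_nhds ⟨rfl, rfl⟩) fun g ⟨hone, hgen⟩ => ⟨?_, hone⟩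
  have hone : g.toPerm 1 = 1 := hone
  have hgen : g.toPerm (gen .a) = gen .a := hgen
  exact g.labelled_of_edge (v := 1) (s := .a) (η := 1) (θ := 1) (by simp [hone, hgen])

theorem isClosed_autPlus : IsClosed (AutPlus : Set Aut) :=
  Subgroup.isClosed_of_isOpen _
    (Subgroup.isOpen_mono baseStabilizer_le_autPlus isOpen_baseStabilizer)

theorem isCompact_signData : IsCompact signData := by
  simp only [signData, Set.ofPred_forall]
  exact (isClosed_iInter fun s => isClosed_iInter fun v => isClosed_iInter fun x =>
    isClosed_iInter fun _ => isClosed_eq (by fun_prop) (by fun_prop)).isCompact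

theorem continuous_signPerm_toAut :
    Continuous fun e : signData => (labelled_signPerm e.2).toAut := by
  refine continuous_iff_toPerm.2 fun v => ?_
  induction v using vertex_induction 1 with
  | base => simpa only [Labelled.toPerm_toAut, signPerm_one] using continuous_const
  | step v s η ih =>
    simp only [Labelled.toPerm_toAut, signPerm_mul_gen_zpow] at ih ⊢
    have hsign : Continuous fun e : signData => e.1 s v :=
      (continuous_apply v).comp ((continuous_apply s).comp continuous_subtype_val)
    exact (continuous_of_discreteTopology (f := fun r : Grp × ℤˣ =>
      r.1 * gen s ^ ((r.2 * η : ℤˣ) : ℤ))).comp (ih.prodMk hsign)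

theorem range_signPerm_toAut :
    Set.range (fun e : signData => (labelled_signPerm e.2).toAut) = baseStabilizer := by
  ext g
  constructor
  · rintro ⟨e, rfl⟩
    exact ⟨labelled_signPerm e.2, signPerm_one e.2⟩
  · rintro ⟨hg, hone⟩
    refine ⟨⟨_, hg.sgn_mem_signData⟩, Aut.toPerm_injective ?_⟩
    refine (labelled_signPerm _).ext_of_sgn hg (u := 1) ?_ ?_
    · rw [signPerm_one, hone]
    · rw [sgn_signPerm]; exact fun _ _ => rfl

theorem isCompact_baseStabilizer : IsCompact (baseStabilizer : Set Aut) := by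
  have := isCompact_iff_compactSpace.1 isCompact_signData
  exact range_signPerm_toAut ▸ isCompact_range continuous_signPerm_toAut

instance : LocallyCompactSpace Aut :=
  isCompact_baseStabilizer.locallyCompactSpace_of_mem_nhds_of_group
    (isOpen_baseStabilizer.mem_nhds (one_mem _))

instance : LocallyCompactSpace AutPlus :=
  isClosed_autPlus.isClosedEmbedding_subtypeVal.locallyCompactSpace

/-- The automorphism that fixes `1` and reverses exactly the lines parallel to the line of label
`d` through `a ^ n`. -/
def flipAt (n : ℕ) : Aut := (labelled_signPerm (flipData_mem_signData .d (gen .a ^ (n : ℤ)))).toAut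

theorem flipAt_mem_baseStabilizer (n : ℕ) : flipAt n ∈ baseStabilizer :=
  ⟨labelled_signPerm _, signPerm_one _⟩

theorem flipAt_injective : Function.Injective flipAt := by
  intro m n h
  have hsigns : flipData .d (gen .a ^ (m : ℤ)) = flipData .d (gen .a ^ (n : ℤ)) := by
    simpa only [flipAt, Labelled.toPerm_toAut, sgn_signPerm] using
      congrArg (fun g : Aut => sgn g.toPerm) h
  have hmem : (gen .a ^ (m : ℤ))⁻¹ * gen .a ^ (n : ℤ) ∈ parabolic (labelStar .d) := by
    simpa [flipData, one_mem] using congrFun₂ hsigns .d (gen .a ^ (n : ℤ))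
  rw [← zpow_neg, ← zpow_add] at hmem
  have ha : Gen.a ∉ labelStar .d := by rintro (h | h) <;> cases h
  have hdiff := eq_zero_of_gen_zpow_mem_parabolic ha hmem
  omega

theorem not_discreteTopology_autPlus : ¬ DiscreteTopology AutPlus := by
  intro _
  have hcompact : IsCompact (((↑) : AutPlus → Aut) ⁻¹' baseStabilizer) :=
    isClosed_autPlus.isClosedEmbedding_subtypeVal.isCompact_preimage isCompact_baseStabilizer
  refine Set.infinite_of_injective_forall_mem (f := fun n : ℕ =>
    (⟨flipAt n, baseStabilizer_le_autPlus (flipAt_mem_baseStabilizer n)⟩ : AutPlus)) ?_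
    flipAt_mem_baseStabilizer (hcompact.finite DiscreteTopology.isDiscrete)
  exact fun m n h => flipAt_injective (congrArg Subtype.val h)

end Topology

section Quotient

/-- The homomorphism to the infinite dihedral group that sends `a` and `d` to reflections and kills
`b` and `c`. It is constant on the orbits of `Aut⁺(X)`. -/
def toDihedral : Grp →* DihedralGroup 0 :=
  liftHom (fun
    | .a => .sr 0
    | .d => .sr 1
    | _ => 1) (by rintro _ _ ⟨⟩ <;> simp)

theorem toDihedral_gen_zpow (s : Gen) (η : ℤˣ) :
    toDihedral (gen s ^ (η : ℤ)) = toDihedral (gen s) := by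
  rcases Int.units_eq_one_or η with rfl | rfl
  · simp
  · cases s <;> simp [toDihedral]

theorem toDihedral_map_of_map_eq {σ : Equiv.Perm Grp} (hσ : Labelled σ) {u : Grp} (hu : σ u = u)
    (v : Grp) : toDihedral (σ v) = toDihedral v := by
  induction v using vertex_induction u with
  | base => rw [hu]
  | step v s η ih =>
    rw [hσ.map_mul_gen_zpow, map_mul, map_mul, toDihedral_gen_zpow,
      toDihedral_gen_zpow, ih]

theorem toDihedral_map_of_mem_autPlus {g : Aut} (hg : g ∈ AutPlus) (v : Grp) :
    toDihedral (g.toPerm v) = toDihedral v := by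
  induction hg using Subgroup.closure_induction generalizing v with
  | mem g hg =>
    obtain ⟨h, hh, hfix⟩ := hg
    obtain ⟨hlabelled, u, hu⟩ := labelled_of_fixes_halfspace hh hfix
    exact toDihedral_map_of_map_eq hlabelled hu v
  | one => rfl
  | mul g h _ _ ihg ihh => rw [Aut.toPerm_mul, Equiv.Perm.mul_apply, ihg, ihh]
  | inv g _ ih => rw [← ih (g⁻¹.toPerm v), Aut.toPerm_inv, ← Equiv.Perm.mul_apply, mul_inv_cancel,
    Equiv.Perm.one_apply]

theorem toDihedral_gen_d_mul_gen_a_pow (n : ℕ) :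
    toDihedral ((gen .d * gen .a) ^ n) = .r (-(n : ℤ)) := by
  have hone : toDihedral (gen .d * gen .a) = .r (-1) := by simp [toDihedral]
  rw [map_pow, hone, DihedralGroup.r_pow]
  exact congrArg DihedralGroup.r (neg_one_mul (n : ℤ))

theorem infinite_quotient_autPlus : Infinite (Aut ⧸ AutPlus) := by
  let translation : ℕ → Aut := fun n => (labelled_mulLeft ((gen .d * gen .a) ^ n)).toAut
  refine Infinite.of_injective (fun n => (translation n : Aut ⧸ AutPlus)) fun m n h => ?_
  have hone : ((translation m)⁻¹ * translation n).toPerm 1 =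
      ((gen .d * gen .a) ^ m)⁻¹ * (gen .d * gen .a) ^ n := by
    rw [Aut.toPerm_mul, Aut.toPerm_inv, Equiv.Perm.mul_apply, Equiv.Perm.inv_eq_iff_eq]
    simp [translation]
  have hinvariant := toDihedral_map_of_mem_autPlus (QuotientGroup.eq.1 h) 1
  rw [hone, map_mul, map_inv, map_one, toDihedral_gen_d_mul_gen_a_pow,
    toDihedral_gen_d_mul_gen_a_pow, inv_mul_eq_one] at hinvariant
  have hneg : -(m : ℤ) = -(n : ℤ) := DihedralGroup.r.inj hinvariant
  omega

theorem not_compactSpace_quotient : ¬ CompactSpace (Aut ⧸ AutPlus.topologicalClosure) := by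
  have hclosure : AutPlus.topologicalClosure = AutPlus :=
    (Subgroup.topologicalClosure_minimal _ le_rfl isClosed_autPlus).antisymm
      (Subgroup.le_topologicalClosure _)
  rw [hclosure]
  intro _
  have := QuotientGroup.discreteTopology
    (Subgroup.isOpen_mono baseStabilizer_le_autPlus isOpen_baseStabilizer)
  exact infinite_quotient_autPlus.not_finite finite_of_compact_of_discrete

end Quotient

section DisjointFamilies

open Equiv Function

theorem pairwise_disjoint_image_pow {α : Type*} {σ : Perm α} {A B : Set α}
    (hσ : σ '' A ⊆ A) (hBA : B ⊆ A) (hdisj : Disjoint B (σ '' A)) :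
    Pairwise (Disjoint on fun i : ℕ => ⇑(σ ^ i) '' B) := by
  have hpow : ∀ n : ℕ, ⇑(σ ^ n) '' A ⊆ A := fun n => by
    induction n with
    | zero => simp
    | succ n ih =>
      rw [pow_succ, Perm.coe_mul, Set.image_comp]
      exact (Set.image_mono hσ).trans ih
  refine (pairwise_disjoint_on _).2 fun i j hij => ?_
  obtain ⟨n, rfl⟩ := Nat.exists_eq_add_of_lt hij
  rw [add_assoc, pow_add, Perm.coe_mul, Set.image_comp, Set.disjoint_image_iff (Equiv.injective _),
    pow_succ', Perm.coe_mul, Set.image_comp]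
  exact hdisj.mono_right (Set.image_mono ((Set.image_mono hBA).trans (hpow n)))

theorem exists_notMem_notMem_of_pairwise_disjoint {ι α : Type*} [Infinite ι]
    {A : ι → Set α} (hA : Pairwise (Disjoint on A)) (v w : α) : ∃ i, v ∉ A i ∧ w ∉ A i := by
  have hfinite : ∀ v, {i | v ∈ A i}.Finite := fun v =>
    Set.Subsingleton.finite fun _ hi _ hj => hA.eq (Set.not_disjoint_iff.2 ⟨v, hi, hj⟩)
  obtain ⟨i, hi⟩ := ((hfinite v).union (hfinite w)).exists_notMem
  exact ⟨i, not_or.1 hi⟩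

theorem pairwise_perm_disjoint_of_map_eq {ι α : Type*} {φ : ι → Perm α} {A : ι → Set α}
    (hA : Pairwise (Disjoint on A)) (hfix : ∀ i, ∀ v ∉ A i, φ i v = v) :
    Pairwise (Perm.Disjoint on φ) := fun i j hij v => by
  by_cases hv : v ∈ A i
  exacts [.inr (hfix j v (Set.disjoint_left.1 (hA hij) hv)), .inl (hfix i v hv)]

variable {ι α : Type*} [Nonempty ι] {φ : ι → Perm α}

/-- The map that applies to `v` a member of the family `φ` that moves `v`, if there is one. -/
def disjointProdFun (φ : ι → Perm α) (v : α) : α := φ (Classical.epsilon fun i => φ i v ≠ v) v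

theorem disjointProdFun_eq {i : ι} {v : α} (h : ∀ j ≠ i, φ j v = v) :
    disjointProdFun φ v = φ i v := by
  by_cases hi : φ i v = v
  · have hall : ∀ j, φ j v = v := fun j => by
      obtain rfl | hj := eq_or_ne j i
      exacts [hi, h j hj]
    rw [hi, disjointProdFun, hall]
  · have hmoves := Classical.epsilon_spec (p := fun i => φ i v ≠ v) ⟨i, hi⟩
    rw [disjointProdFun, not_ne_iff.1 fun hne => hmoves (h _ hne)]

theorem exists_forall_ne_map_eq (hφ : Pairwise (Perm.Disjoint on φ)) (v : α) :
    ∃ i, ∀ j ≠ i, φ j v = v := by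
  by_cases hv : ∃ i, φ i v ≠ v
  · obtain ⟨i, hi⟩ := hv
    exact ⟨i, fun j hj => (hφ hj v).resolve_right hi⟩
  · push Not at hv
    exact ⟨Classical.arbitrary ι, fun j _ => hv j⟩

theorem disjointProdFun_inv_disjointProdFun (hφ : Pairwise (Perm.Disjoint on φ)) (v : α) :
    disjointProdFun (fun i => (φ i)⁻¹) (disjointProdFun φ v) = v := by
  obtain ⟨i, hi⟩ := exists_forall_ne_map_eq hφ v
  rw [disjointProdFun_eq hi, disjointProdFun_eq (i := i) fun j hj => ?_, Perm.inv_eq_iff_eq]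
  rw [Perm.inv_eq_iff_eq, ← Perm.mul_apply, (hφ hj).commute.eq, Perm.mul_apply, hi j hj]

/-- The product of a possibly infinite family of permutations with disjoint supports. -/
def disjointProd (φ : ι → Perm α) (hφ : Pairwise (Perm.Disjoint on φ)) : Perm α where
  toFun := disjointProdFun φ
  invFun := disjointProdFun fun i => (φ i)⁻¹
  left_inv := disjointProdFun_inv_disjointProdFun hφ
  right_inv v := by
    simpa using disjointProdFun_inv_disjointProdFun (φ := fun i => (φ i)⁻¹)
      (fun i j hij => Perm.disjoint_inv_left_iff.2 (Perm.disjoint_inv_right_iff.2 (hφ hij))) v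

theorem disjointProd_apply {hφ : Pairwise (Perm.Disjoint on φ)} {i : ι} {v : α}
    (h : ∀ j ≠ i, φ j v = v) : disjointProd φ hφ v = φ i v :=
  disjointProdFun_eq h

-- Conjugation by `m` shifts the factors of the product, which telescopes the commutator.
theorem disjointProd_conj_pow_mul {m f : Perm α}
    (hφ : Pairwise (Perm.Disjoint on fun i : ℕ => m ^ i * f * (m ^ i)⁻¹)) :
    disjointProd _ hφ * m = f * m * disjointProd _ hφ := by
  set φ : ℕ → Perm α := fun i => m ^ i * f * (m ^ i)⁻¹
  have hzero : φ 0 = f := by simp [φ]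
  have hshift : ∀ i v, φ (i + 1) (m v) = m (φ i v) := fun i v => by
    simp [φ, pow_succ', mul_inv_rev]
  ext v
  simp only [Perm.mul_apply]
  by_cases hf : f (m v) = m v
  · obtain ⟨i, hi⟩ := exists_forall_ne_map_eq hφ v
    have hi' : ∀ j ≠ i + 1, φ j (m v) = m v := by
      rintro (_ | j) hj
      · rw [hzero, hf]
      · rw [hshift, hi j (by simpa using hj)]
    have hcomm : Commute f (φ (i + 1)) := hzero ▸ (hφ (Nat.succ_ne_zero i).symm).commute
    have happly : f (φ (i + 1) (m v)) = φ (i + 1) (f (m v)) := DFunLike.congr_fun hcomm.eq (m v)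
    rw [disjointProd_apply hi', disjointProd_apply hi, ← hshift, happly, hf]
  · have hmove : ∀ j ≠ 0, φ j (m v) = m v := fun j hj =>
      (hφ hj (m v)).resolve_right (by rwa [hzero])
    have hfix : ∀ i, φ i v = v := fun i =>
      m.injective ((hshift i v).symm.trans (hmove _ (Nat.succ_ne_zero i)))
    rw [disjointProd_apply hmove, disjointProd_apply (i := 0) fun j _ => hfix j, hfix, hzero]

end DisjointFamilies

section Simple

variable {σ : Equiv.Perm Grp} {s : Gen}

theorem Labelled.inv_mul_map_mem_link (hσ : Labelled σ)
    (h : ∀ v, v⁻¹ * σ v ∈ parabolic {s}ᶜ) (v : Grp) : v⁻¹ * σ v ∈ parabolic (labelLink s) := by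
  have hside := isFarSide_farSide s v 1
  have hmem : ∀ w, σ w ∈ farSide s v 1 ↔ w ∈ farSide s v 1 := fun w => by
    simpa using hside.mul_mem_iff w (h w)
  have hcross := (hside v s 1).2 ⟨rfl, rfl, by simp [one_mem]⟩
  have hcross' : σ v ∉ farSide s v 1 ∧ σ v * gen s ^ (sgn σ s v : ℤ) ∈ farSide s v 1 := by
    rw [hmem, ← hσ.map_mul_gen, hmem]
    simpa using hcross
  exact ((hside (σ v) s _).1 hcross').2.2

theorem Labelled.exists_inv_mul_map_notMem (hσ : Labelled σ) (hne : σ ≠ 1) :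
    ∃ v, v⁻¹ * σ v ∉ parabolic {Gen.a}ᶜ := by
  by_contra! h
  have hlink_a := hσ.inv_mul_map_mem_link h
  have hlink_d := hσ.inv_mul_map_mem_link (s := .d) fun v =>
    parabolic_mono (by rintro _ ⟨⟩; simp) (hlink_a v)
  have hdisj : Disjoint (labelLink .a) (labelLink .d) := by
    rw [Set.disjoint_left]; rintro _ ⟨⟩ h; cases h
  refine hne (Equiv.ext fun v => (inv_mul_eq_one.1 ?_).symm)
  exact Subgroup.disjoint_def.1 (disjoint_parabolic hdisj) (hlink_a v) (hlink_d v)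

theorem disjoint_farSide_mul {x : Grp} (hx : x ∈ parabolic {s}ᶜ)
    (hlink : x ∉ parabolic (labelLink s)) (v : Grp) (ε δ : ℤˣ) :
    Disjoint (farSide s v ε) (farSide s (v * x) δ) := by
  have hv := isFarSide_farSide s v ε
  have hvx := isFarSide_farSide s (v * x) δ
  refine hv.disjoint hvx (mt (hvx.mul_mem_iff v hx).2 hvx.notMem)
    (mt (hv.mul_mem_iff v hx).1 hv.notMem) fun h => hlink (by simpa using h.1)

theorem gen_d_zpow_notMem_link {k : ℤ} (hk : k ≠ 0) : gen .d ^ k ∉ parabolic (labelLink .a) :=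
  mt (eq_zero_of_gen_zpow_mem_parabolic (by rintro ⟨⟩)) hk

theorem pairwise_disjoint_farSide_mul_gen_d (v : Grp) (ε : ℤˣ) :
    Pairwise (Function.onFun Disjoint fun k : ℤ => farSide .a (v * gen .d ^ k) ε) := by
  intro k l hkl
  have h := disjoint_farSide_mul (gen_zpow_mem_parabolic (by simp) (l - k))
    (gen_d_zpow_notMem_link (sub_ne_zero.2 hkl.symm)) (v * gen .d ^ k) ε ε
  rwa [mul_assoc, ← zpow_add, add_sub_cancel] at h

theorem Labelled.disjoint_image_farSide (hσ : Labelled σ) {v p : Grp} {ε : ℤˣ}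
    (hvp : v⁻¹ * p ∈ parabolic {s}ᶜ) (hv : v⁻¹ * σ v ∉ parabolic {s}ᶜ)
    (hmap : σ v ∉ farSide s p ε) (hinv : σ⁻¹ v ∉ farSide s p ε) :
    Disjoint (farSide s p ε) (σ '' farSide s p ε) := by
  have hside := isFarSide_farSide s p ε
  have htransfer : ∀ {τ : Equiv.Perm Grp}, Labelled τ →
      (τ p ∈ farSide s p ε ↔ τ v ∈ farSide s p ε) := fun {τ} hτ => by
    simpa using hside.mul_mem_iff (τ v) (hτ.inv_mul_map_mem_parabolic hvp)
  refine hside.disjoint (hside.image hσ) ?_ (by rwa [htransfer hσ]) fun h => hv ?_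
  · rintro ⟨w, hw, rfl⟩
    rw [← htransfer hσ.inv] at hinv
    simp_all
  · have hp := parabolic_mono (labelLink_subset_compl s) h.1
    have := mul_mem (mul_mem hvp hp) (inv_mem (hσ.inv_mul_map_mem_parabolic hvp))
    simpa [mul_assoc] using this

theorem Labelled.exists_disjoint_image_farSide (hσ : Labelled σ) (hne : σ ≠ 1) :
    ∃ u, Disjoint (farSide .a u 1) (σ '' farSide .a u 1) := by
  obtain ⟨v, hv⟩ := hσ.exists_inv_mul_map_notMem hne
  obtain ⟨k, hmap, hinv⟩ := exists_notMem_notMem_of_pairwise_disjoint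
    (pairwise_disjoint_farSide_mul_gen_d v 1) (σ v) (σ⁻¹ v)
  refine ⟨_, hσ.disjoint_image_farSide ?_ hv hmap hinv⟩
  simpa using gen_zpow_mem_parabolic (by simp) k

theorem labelled_disjointProd {ι : Type*} [Nonempty ι] {φ : ι → Equiv.Perm Grp}
    {A : ι → Set Grp} {u : ι → Grp} {ε : ι → ℤˣ} (hside : ∀ i, IsFarSide (A i) s (u i) (ε i))
    (hA : Pairwise (Function.onFun Disjoint A))
    (hφ : ∀ i, Labelled (φ i) ∧ ∀ v ∉ A i, φ i v = v) :
    Labelled (disjointProd φ (pairwise_perm_disjoint_of_map_eq hA fun i => (hφ i).2)) := by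
  have hedge : ∀ {v w}, IsEdge v w → ∃ i, ∀ j ≠ i, φ j v = v ∧ φ j w = w := by
    intro v w hvw
    have hfix : ∀ {j}, v ∉ A j → φ j v = v ∧ φ j w = w := fun {j} hv =>
      ⟨(hφ j).2 v hv, (hside j).map_eq_of_isEdge (hφ j).1 (hφ j).2 hv hvw⟩
    by_cases hv : ∃ i, v ∈ A i
    · obtain ⟨i, hi⟩ := hv
      exact ⟨i, fun j hji => hfix (Set.disjoint_right.1 (hA hji) hi)⟩
    · exact ⟨Classical.arbitrary ι, fun j _ => hfix fun hj => hv ⟨j, hj⟩⟩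
  intro v t
  obtain ⟨i, hi⟩ := hedge (v := v) (w := v * gen t) (by simpa using isEdge_mul_gen_zpow v t 1)
  rw [disjointProd_apply fun j hj => (hi j hj).1, disjointProd_apply fun j hj => (hi j hj).2]
  exact (hφ i).1 v t

theorem IsFarSide.exists_commutator {S : Set Grp} {u : Grp} {ε : ℤˣ} (h : IsFarSide S s u ε)
    {m f : Aut} (hm : Labelled m.toPerm)
    (hdisj : Pairwise (Function.onFun Disjoint fun i : ℕ => ⇑(m.toPerm ^ i) '' S))
    (hf : f ∈ rigidStabilizer S) : ∃ F ∈ AutPlus, f = F * m * F⁻¹ * m⁻¹ := by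
  let φ : ℕ → Equiv.Perm Grp := fun i => m.toPerm ^ i * f.toPerm * (m.toPerm ^ i)⁻¹
  have hφ : ∀ i, Labelled (φ i) ∧ ∀ v ∉ ⇑(m.toPerm ^ i) '' S, φ i v = v := fun i =>
    conj_mem_rigidStabilizer (g := (hm.pow i).toAut) (hm.pow i) hf
  have hφ_disj := pairwise_perm_disjoint_of_map_eq hdisj fun i => (hφ i).2
  have hlabelled : Labelled (disjointProd φ hφ_disj) :=
    labelled_disjointProd (fun i => h.image (hm.pow i)) hdisj hφ
  have hbase : disjointProd φ hφ_disj (u * gen s ^ (ε : ℤ)) = u * gen s ^ (ε : ℤ) := by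
    have hmem : u * gen s ^ (ε : ℤ) ∈ ⇑(m.toPerm ^ 0) '' S := by
      simpa using ((h u s ε).2 ⟨rfl, rfl, by simp [one_mem]⟩).2
    rw [disjointProd_apply (i := 0) fun j hj =>
      (hφ j).2 _ (Set.disjoint_right.1 (hdisj hj) hmem)]
    simpa [φ] using h.map_eq_of_isEdge hf.1 hf.2 h.notMem (isEdge_mul_gen_zpow u s ε)
  refine ⟨hlabelled.toAut, mem_autPlus_of_map_eq hlabelled hbase, ?_⟩
  rw [eq_mul_inv_iff_mul_eq, eq_mul_inv_iff_mul_eq]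
  exact Aut.toPerm_injective (disjointProd_conj_pow_mul hφ_disj).symm

theorem lineFlip_mem_autPlus (s : Gen) (u : Grp) : (labelled_lineFlip s u).toAut ∈ AutPlus :=
  mem_autPlus_of_map_eq (labelled_lineFlip s u) (lineFlip_self s u)

theorem image_lineFlip_farSide (s : Gen) (u : Grp) (ε : ℤˣ) :
    lineFlip s u '' farSide s u ε = farSide s u (-ε) := by
  rw [(labelled_lineFlip s u).image_farSide, lineFlip_self, sgn_lineFlip_self, neg_one_mul]

theorem image_lineFlip_compl_farSide (s : Gen) (u : Grp) (ε : ℤˣ) :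
    lineFlip s (u * gen s ^ (ε : ℤ)) '' (farSide s u ε)ᶜ = farSide s (u * gen s ^ (ε : ℤ)) ε := by
  rw [compl_farSide, image_lineFlip_farSide, neg_neg]

theorem farSide_mul_gen_zpow_subset (s : Gen) (u : Grp) (ε : ℤˣ) :
    farSide s (u * gen s ^ (ε : ℤ)) ε ⊆ farSide s u ε := by
  have h := disjoint_farSide_neg s (u * gen s ^ (ε : ℤ)) ε
  rw [← compl_farSide] at h
  exact Set.disjoint_compl_right_iff_subset.1 h

theorem IsFarSide.exists_farSide_subset_or_subset_compl {S : Set Grp} {u u' : Grp} {ε : ℤˣ}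
    (h : IsFarSide S s u ε) (hu' : u' ∉ S) :
    ∃ η, farSide s u' η ⊆ S ∨ farSide s u' η ⊆ Sᶜ := by
  by_cases hlink : u⁻¹ * u' ∈ parabolic (labelLink s)
  · exact ⟨ε, .inl ((h.congr_base hlink).unique (isFarSide_farSide s u' ε)).ge⟩
  · have hη : ∃ η, u ∉ farSide s u' η := by
      by_contra! hmem
      exact Set.disjoint_left.1 (disjoint_farSide_neg s u' 1) (hmem _) (hmem _)
    obtain ⟨η, hη⟩ := hη
    have hdisj := h.disjoint (isFarSide_farSide s u' η) hη hu' fun h => hlink h.1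
    exact ⟨η, .inr hdisj.symm.subset_compl_right⟩

theorem exists_image_farSide_subset (s : Gen) (u u' : Grp) (ε ε' : ℤˣ) :
    ∃ g ∈ AutPlus, g.toPerm '' farSide s u' ε' ⊆ farSide s u ε := by
  have hnested : ∃ η, farSide s u' η ⊆ farSide s u ε ∨ farSide s u' η ⊆ (farSide s u ε)ᶜ := by
    have h := isFarSide_farSide s u ε
    by_cases hu' : u' ∈ farSide s u ε
    · obtain ⟨η, hη⟩ := h.compl.exists_farSide_subset_or_subset_compl (Set.notMem_compl_iff.2 hu')
      exact ⟨η, by rwa [compl_compl, or_comm] at hη⟩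
    · exact h.exists_farSide_subset_or_subset_compl hu'
  obtain ⟨η, hη⟩ := hnested
  have hturn : ∃ g ∈ AutPlus, g.toPerm '' farSide s u' ε' = farSide s u' η := by
    obtain rfl | hne := eq_or_ne η ε'
    · exact ⟨1, one_mem _, by simp⟩
    · refine ⟨_, lineFlip_mem_autPlus s u', ?_⟩
      rw [Labelled.toPerm_toAut, image_lineFlip_farSide, Int.units_ne_iff_eq_neg.1 hne]
  obtain ⟨g, hg, himage⟩ := hturn
  rcases hη with hη | hη
  · exact ⟨g, hg, himage ▸ hη⟩
  · refine ⟨_, mul_mem (lineFlip_mem_autPlus s (u * gen s ^ (ε : ℤ))) hg, ?_⟩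
    rw [Aut.toPerm_mul, Equiv.Perm.coe_mul, Set.image_comp, himage, Labelled.toPerm_toAut]
    refine (Set.image_mono hη).trans ?_
    rw [image_lineFlip_compl_farSide]
    exact farSide_mul_gen_zpow_subset s u ε

theorem image_conj_lineFlip_mul_subset {n : Aut} {u : Grp} {ε : ℤˣ}
    (hdisj : Disjoint (farSide s u ε) (n.toPerm '' farSide s u ε)) :
    let r := (labelled_lineFlip s (u * gen s ^ (ε : ℤ))).toAut
    (r * n * r⁻¹ * n).toPerm '' farSide s u ε ⊆ farSide s (u * gen s ^ (ε : ℤ)) ε := by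
  intro r
  have hr : ∀ v ∉ farSide s u ε, r.toPerm v ∈ farSide s (u * gen s ^ (ε : ℤ)) ε := fun v hv =>
    image_lineFlip_compl_farSide s u ε ▸ Set.mem_image_of_mem _ hv
  have hrinv : ∀ v ∉ farSide s u ε, r.toPerm⁻¹ v ∈ farSide s u ε := fun v hv => by
    by_contra hnot
    have hmem := farSide_mul_gen_zpow_subset s u ε (hr _ hnot)
    rw [← Equiv.Perm.mul_apply, mul_inv_cancel] at hmem
    exact hv hmem
  have hn : ∀ v ∈ farSide s u ε, n.toPerm v ∉ farSide s u ε := fun v hv =>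
    Set.disjoint_right.1 hdisj (Set.mem_image_of_mem _ hv)
  rintro _ ⟨v, hv, rfl⟩
  exact hr _ (hn _ (hrinv _ (hn v hv)))

theorem exists_rigidStabilizer_le_of_normalized {M : Subgroup Aut} (hM : M ≤ AutPlus)
    (hconj : ∀ g ∈ AutPlus, ∀ n ∈ M, g * n * g⁻¹ ∈ M) (hbot : M ≠ ⊥) :
    ∃ u ε, rigidStabilizer (farSide .a u ε) ≤ M := by
  obtain ⟨n, hn, hne⟩ := M.bot_or_exists_ne_one.resolve_left hbot
  obtain ⟨u, hdisj⟩ := (labelled_of_mem_autPlus (hM hn)).exists_disjoint_image_farSide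
    (mt (fun h => Aut.toPerm_injective h) hne)
  set w := u * gen .a ^ ((1 : ℤˣ) : ℤ) with hw
  set r := (labelled_lineFlip .a w).toAut
  set m := r * n * r⁻¹ * n
  have hm : m ∈ M := mul_mem (hconj r (lineFlip_mem_autPlus .a w) n hn) hn
  have hmap : m.toPerm '' farSide .a u 1 ⊆ farSide .a w 1 := image_conj_lineFlip_mul_subset hdisj
  have hdisj_d : ∀ ε, Disjoint (farSide .a w ε) (farSide .a (w * gen .d) 1) := fun ε => by
    simpa using disjoint_farSide_mul (gen_zpow_mem_parabolic (by simp) 1)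
      (gen_d_zpow_notMem_link one_ne_zero) w ε 1
  have hsubset : farSide .a (w * gen .d) 1 ⊆ farSide .a u 1 := by
    have h := (hdisj_d (-1)).subset_compl_left
    rwa [hw, ← compl_farSide, compl_compl] at h
  have htranslates := pairwise_disjoint_image_pow
    (hmap.trans (farSide_mul_gen_zpow_subset .a u 1)) hsubset ((hdisj_d 1).symm.mono_right hmap)
  refine ⟨w * gen .d, 1, fun f hf => ?_⟩
  obtain ⟨F, hF, rfl⟩ := (isFarSide_farSide .a _ 1).exists_commutator
    (labelled_of_mem_autPlus (hM hm)) htranslates hf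
  exact mul_mem (hconj F hF m hm) (inv_mem hm)

theorem autPlus_le_of_normalized {M : Subgroup Aut} (hM : M ≤ AutPlus)
    (hconj : ∀ g ∈ AutPlus, ∀ n ∈ M, g * n * g⁻¹ ∈ M) (hbot : M ≠ ⊥) : AutPlus ≤ M := by
  obtain ⟨u, ε, hle⟩ := exists_rigidStabilizer_le_of_normalized hM hconj hbot
  rw [autPlus_eq_sideGroup]
  refine iSup₂_le fun u' ε' f hf => ?_
  obtain ⟨g, hg, himage⟩ := exists_image_farSide_subset .a u u' ε ε'
  have hmem : g * f * g⁻¹ ∈ M :=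
    hle (rigidStabilizer_mono himage (conj_mem_rigidStabilizer (labelled_of_mem_autPlus hg) hf))
  simpa [mul_assoc] using hconj g⁻¹ (inv_mem hg) _ hmem

instance : Nontrivial AutPlus :=
  ⟨⟨flipAt 0, baseStabilizer_le_autPlus (flipAt_mem_baseStabilizer 0)⟩,
    ⟨flipAt 1, baseStabilizer_le_autPlus (flipAt_mem_baseStabilizer 1)⟩,
    fun h => zero_ne_one (flipAt_injective (congrArg Subtype.val h))⟩

theorem isSimpleGroup_autPlus : IsSimpleGroup AutPlus where
  eq_bot_or_eq_top_of_normal N hN := by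
    refine or_iff_not_imp_left.2 fun hbot => ?_
    have hconj : ∀ g ∈ AutPlus, ∀ n ∈ N.map AutPlus.subtype,
        g * n * g⁻¹ ∈ N.map AutPlus.subtype := by
      rintro g hg _ ⟨n, hn, rfl⟩
      exact ⟨_, hN.conj_mem n hn ⟨g, hg⟩, rfl⟩
    have hle := autPlus_le_of_normalized (Subgroup.map_subtype_le N) hconj
      (mt (N.map_eq_bot_iff_of_injective AutPlus.subtype_injective).1 hbot)
    rw [eq_top_iff, ← Subgroup.map_subtype_le_map_subtype]
    exact (Subgroup.map_subtype_le ⊤).trans hle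

end Simple

end CrokeKleiner

end

theorem mainTheorem10 :
    ∃ _ : IsTopologicalGroup CrokeKleiner.Aut,
      ¬ CompactSpace (CrokeKleiner.Aut ⧸ CrokeKleiner.AutPlus.topologicalClosure) ∧
      IsSimpleGroup CrokeKleiner.AutPlus ∧
      ¬ DiscreteTopology CrokeKleiner.AutPlus ∧
      TotallyDisconnectedSpace CrokeKleiner.AutPlus ∧
      LocallyCompactSpace CrokeKleiner.AutPlus :=
  ⟨inferInstance, CrokeKleiner.not_compactSpace_quotient, CrokeKleiner.isSimpleGroup_autPlus,
    CrokeKleiner.not_discreteTopology_autPlus, inferInstance, inferInstance⟩
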